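/- Let $\mathbb S^1=\mathbb R/2\pi\mathbb Z$ and identify vector fields on $\mathbb S^1$ with functions. Let $B:\mathbb S^1\to(0,\infty)$ be Lipschitz, $m\ge 1$, and for $0<\epsilon<\epsilon_0$ let $A^\epsilon_0\in C^0(\mathbb S^1)$ and $A^\epsilon_1,\dots,A^\epsilon_m\in C^1(\mathbb S^1)$ satisfy $\min_{\mathbb S^1}\sum_{i=1}^m|A^\epsilon_i|^2>0$ for each $\epsilon$ and $$\lim_{\epsilon\to0}\epsilon^2\Big(\|A^\epsilon_0\|_\infty+\sum_{i=1}^m\|A^\epsilon_i\|_{1,\infty}^2\Big)=0,$$ where $\|f\|_{k,\infty}=\sum_{j\le k}\|f^{(j)}\|_\infty$. A stationary measure of the Stratonovich SDE $$dX_t=B(X_t)\,dt+\epsilon^2A^\epsilon_0(X_t)\,dt+\epsilon\sum_{i=1}^mA^\epsilon_i(X_t)\circ dW^i_t$$ is a Borel probability measure $\mu$ on $\mathbb S^1$ with $\int\mathcal L_\epsilon f\,d\mu=0$ for all $f\in C^2(\mathbb S^1)$, where $\mathcal L_\epsilon f=\frac{\epsilon^2}{2}\sum_{i=1}^m A^\epsilon_i(A^\epsilon_if')'+(B+\epsilon^2A^\epsilon_0)f'$.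 Then the ODE $\dot x=B(x)$ on $\mathbb S^1$ has a unique invariant probability measure; its density is $u_0=\gamma/B$ with $\gamma=(\int_{\mathbb S^1} 1/B)^{-1}$. For each $\epsilon\in(0,\epsilon_0)$ the SDE has a unique stationary measure, and it has a continuous positive density $u_\epsilon$. Moreover: 1. There are $c,C,\epsilon_1>0$ such that $c\le\min u_\epsilon\le\max u_\epsilon\le C$ for all $0<\epsilon<\epsilon_1$, and $u_\epsilon\to u_0$ weakly in $L^p(\mathbb S^1)$ as $\epsilon\to0$ for every $1<p<\infty$. 2. If in addition $A^\epsilon_0\in C^1$, $A^\epsilon_i\in C^2$ for $i=1,\dots,m$, and $$\lim_{\epsilon\to0}\epsilon^2\Big(\|A^\epsilon_0\|_{1,\infty}+\sum_{i=1}^m\|A^\epsilon_i\|_{2,\infty}^2\Big)=0,$$ then $u_\epsilon\in C^1$, there are $C,\epsilon_1>0$ with $\|u_\epsilon'\|_\infty\le C$ for all $0<\epsilon<\epsilon_1$, and $u_\epsilon\to u_0$ in $C^\alpha(\mathbb S^1)$ as $\epsilon\to0$ for every $\alpha\in(0,1)$. -/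

import Mathlib

open Filter Topology MeasureTheory
open scoped ENNReal NNReal

noncomputable section

namespace CircleSDE

instance instTwoPiPos : Fact (0 < 2 * Real.pi) := ⟨Real.two_pi_pos⟩

/-- The circle `ℝ / 2πℤ`; its `volume` is arc length, of total mass `2π`. A vector field on the
circle is identified with its coefficient function `X : S1 → ℝ`, i.e. with `X d/dθ`. -/
abbrev S1 : Type := AddCircle (2 * Real.pi)

/-- The derivative `f' = df/dθ` of a function on the circle. -/
def D (f : S1 → ℝ) (θ : S1) : ℝ := deriv (fun t : ℝ => f (θ + (t : S1))) 0

/-- `f` is of class `C^k` on the circle: its `2π`-periodic lift to `ℝ` is `C^k`. -/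
def IsCk (k : ℕ) (f : S1 → ℝ) : Prop := ContDiff ℝ k (fun x : ℝ => f (x : S1))

/-- The supremum norm (for bounded functions). -/
def supNorm (f : S1 → ℝ) : ℝ := ⨆ θ, |f θ|

/-- The norm `‖f‖_{k,∞} = ∑_{j ≤ k} ‖f^{(j)}‖_∞` (for functions of class `C^k`). -/
def ckNorm (k : ℕ) (f : S1 → ℝ) : ℝ := ∑ j ∈ Finset.range (k + 1), supNorm (D^[j] f)

/-- The absolutely continuous measure `u dθ`. -/
def densityMeasure (u : S1 → ℝ) : Measure S1 :=
  (volume : Measure S1).withDensity (fun θ => ENNReal.ofReal (u θ))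

/-- `c` is a global solution of the ODE `ċ = B(c)` on the circle (in terms of a lift to `ℝ`). -/
def IsSolution (B : S1 → ℝ) (c : ℝ → S1) : Prop :=
  ∃ γ : ℝ → ℝ, (∀ t, ((γ t : ℝ) : S1) = c t) ∧ ∀ t, HasDerivAt γ (B ((γ t : ℝ) : S1)) t

/-- `φ t x` is the value at time `t` of the solution of `ẋ = B(x)` starting at `x`. -/
def IsFlow (B : S1 → ℝ) (φ : ℝ → S1 → S1) : Prop :=
  ∀ x, φ 0 x = x ∧ IsSolution B (fun t => φ t x)

/-- `μ` is an invariant (probability) measure of the ODE `ẋ = B(x)`. (For Lipschitz `B`, the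
flow is unique.) -/
def IsInvariantMeasure (B : S1 → ℝ) (μ : Measure S1) : Prop :=
  IsProbabilityMeasure μ ∧ ∃ φ : ℝ → S1 → S1, IsFlow B φ ∧ ∀ t, MeasurePreserving (φ t) μ μ

/-- The vector field `X` acting on a function as a derivation: `X f = X f'`. -/
def vf (X : S1 → ℝ) (f : S1 → ℝ) (θ : S1) : ℝ := X θ * D f θ

/-- The generator `L f = ½ ∑ᵢ Xᵢ(Xᵢ f) + X₀ f` of the Stratonovich SDE
`dx = X₀(x) dt + ∑ᵢ Xᵢ(x) ∘ dWⁱ`. -/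
def generator {m : ℕ} (X₀ : S1 → ℝ) (X : Fin m → S1 → ℝ) (f : S1 → ℝ) (θ : S1) : ℝ :=
  (1 / 2) * ∑ i, vf (X i) (vf (X i) f) θ + vf X₀ f θ

/-- `μ` is a stationary measure of the Stratonovich SDE `dx = X₀(x) dt + ∑ᵢ Xᵢ(x) ∘ dWⁱ`:
a probability measure with `X₀, Xᵢ' ∈ L¹(μ)` and `∫ L f dμ = 0` for all `f ∈ C²`. -/
def IsStationaryMeasure {m : ℕ} (X₀ : S1 → ℝ) (X : Fin m → S1 → ℝ) (μ : Measure S1) : Prop :=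
  IsProbabilityMeasure μ ∧ Integrable X₀ μ ∧ (∀ i, Integrable (D (X i)) μ) ∧
    ∀ f : S1 → ℝ, IsCk 2 f → ∫ θ, generator X₀ X f θ ∂μ = 0

/-- The drift `B + ε² A₀` of the perturbed equation. -/
def drift (B : S1 → ℝ) (ε : ℝ) (A₀ : S1 → ℝ) (θ : S1) : ℝ := B θ + ε ^ 2 * A₀ θ

/-- The diffusion vector fields `ε Aᵢ` of the perturbed equation. -/
def noise {m : ℕ} (ε : ℝ) (A : Fin m → S1 → ℝ) (i : Fin m) (θ : S1) : ℝ := ε * A i θ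

/-- `u_ε → u₀` weakly in `L^p` as `ε → 0⁺`: convergence in the weak topology of `L^p(S¹)`. -/
def TendstoWeaklyLp (p : ℝ≥0∞) [Fact (1 ≤ p)] (u : ℝ → C(S1, ℝ)) (u₀ : C(S1, ℝ)) : Prop :=
  Tendsto
    (fun ε => toWeakSpace ℝ (Lp ℝ p (volume : Measure S1))
      (ContinuousMap.toLp p (volume : Measure S1) ℝ (u ε)))
    (𝓝[>] 0)
    (𝓝 (toWeakSpace ℝ (Lp ℝ p (volume : Measure S1))
      (ContinuousMap.toLp p (volume : Measure S1) ℝ u₀)))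

/-- The norm `‖f‖_∞ + [f]_α` of the Hölder space `C^α`, with values in `[0, ∞]`. -/
def holderENorm (α : ℝ≥0) (f : C(S1, ℝ)) : ℝ≥0∞ :=
  ENNReal.ofReal ‖f‖ + eHolderNorm α (fun θ => f θ)

/-- `u_ε → u₀` in `C^α` as `ε → 0⁺`. -/
def TendstoHolder (α : ℝ≥0) (u : ℝ → C(S1, ℝ)) (u₀ : C(S1, ℝ)) : Prop :=
  Tendsto (fun ε => holderENorm α (u ε - u₀)) (𝓝[>] 0) (𝓝 0)

end CircleSDE

end

namespace CircleSDE

/-! With `a = ε²/2 ∑ Aᵢ²` and `h = B + ε² A₀ - a'/2`, the generator is `a f'' + (h + a') f'`. Its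
adjoint equation `(a u' - h u)' = 0` integrates once to `a u' = h u - J` with a constant flux `J`.
Everything about the SDE is read off this scalar first-order equation.

A positive normalised solution comes from variation of constants, with `J` fixed by periodicity
(`exists_isFluxSolution`). It is the only stationary density because `L f = φ` has a `C²` solution
whenever `∫ u φ = 0` (`IsFluxSolution.exists_poisson_solution`); testing a stationary measure on
such `f` determines all its integrals.

The estimates use only the maximum principle, so they survive the degeneration `a → 0`. At an
extremum of `u` one has `h u = J`, which gives two-sided bounds (`IsFluxSolution.bounds`). At an
extremum of `u - J/B`, `|u'|` is at most the Lipschitz constant of `J/B`, so `h u - J = a u'` is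
small there; hence `u - J/B` is uniformly small, and normalisation forces `J → γ`
(`exists_uniform_bounds`). Convergence is thus uniform, which is more than weak `L^p` convergence.
Under the stronger hypotheses `h` is uniformly Lipschitz, and a maximum principle for `u'` bounds it
uniformly (`IsFluxSolution.abs_deriv_le`); interpolation then gives convergence in `C^α`.

For the ODE, the time coordinate `G = ∫ 1/B` turns the flow into a translation of period `∫ 1/B`;
averaging over one period identifies the invariant measure (`isInvariantMeasure_iff`). -/

/-! ### Calculus and integration on the circle through periodic lifts. -/

theorem D_coe (f : S1 → ℝ) (x : ℝ) : D f (x : S1) = deriv (fun y : ℝ => f (y : S1)) x := by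
  have h := deriv_comp_const_add (fun y : ℝ => f (y : S1)) x 0
  rw [add_zero] at h
  rw [← h]
  simp only [D, AddCircle.coe_add]

theorem forall_S1 {p : S1 → Prop} : (∀ θ, p θ) ↔ ∀ x : ℝ, p (x : S1) :=
  ⟨fun h x => h x, fun h θ => by
    induction θ using QuotientAddGroup.induction_on with
    | H x => exact h x⟩

theorem continuous_iff_lift {X : Type*} [TopologicalSpace X] {f : S1 → X} :
    Continuous f ↔ Continuous fun x : ℝ => f (x : S1) :=
  (QuotientAddGroup.isQuotientMap_mk (N := AddSubgroup.zmultiples (2 * Real.pi))).continuous_iff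

theorem coe_add_two_pi (x : ℝ) : ((x + 2 * Real.pi : ℝ) : S1) = (x : S1) :=
  AddCircle.coe_add_period _ x

theorem exists_lift {X : Type*} {g : ℝ → X} (hg : ∀ x, g (x + 2 * Real.pi) = g x) :
    ∃ f : S1 → X, ∀ x : ℝ, f (x : S1) = g x :=
  ⟨Function.Periodic.lift (c := 2 * Real.pi) hg, fun x => Function.Periodic.lift_coe hg x⟩

theorem exists_continuousMap {g : ℝ → ℝ} (hg : ∀ x, g (x + 2 * Real.pi) = g x)
    (hc : Continuous g) : ∃ f : C(S1, ℝ), ∀ x : ℝ, f (x : S1) = g x := by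
  obtain ⟨f, hf⟩ := exists_lift hg
  exact ⟨⟨f, continuous_iff_lift.2 (by simpa only [hf] using hc)⟩, hf⟩

theorem integral_eq_interval (f : S1 → ℝ) (t : ℝ) :
    ∫ θ, f θ = ∫ x in t..t + 2 * Real.pi, f (x : S1) :=
  (AddCircle.intervalIntegral_preimage (2 * Real.pi) t f).symm

theorem integral_eq_interval_zero (f : S1 → ℝ) :
    ∫ θ, f θ = ∫ x in (0 : ℝ)..2 * Real.pi, f (x : S1) := by
  simpa using integral_eq_interval f 0

theorem integrable_of_continuous {f : S1 → ℝ} (hf : Continuous f) (μ : Measure S1)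
    [IsFiniteMeasure μ] : Integrable f μ :=
  hf.integrable_of_hasCompactSupport (HasCompactSupport.of_compactSpace f)

theorem integral_densityMeasure {u : S1 → ℝ} (hu : Continuous u) (hpos : ∀ θ, 0 < u θ)
    (f : S1 → ℝ) : ∫ θ, f θ ∂densityMeasure u = ∫ θ, u θ * f θ := by
  rw [densityMeasure, integral_withDensity_eq_integral_toReal_smul
    (hu.measurable.ennreal_ofReal) (by simp)]
  simp only [ENNReal.toReal_ofReal (hpos _).le, smul_eq_mul]

theorem densityMeasure_isProbabilityMeasure {u : S1 → ℝ} (hu : Continuous u)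
    (hpos : ∀ θ, 0 < u θ) (h1 : ∫ θ, u θ = 1) : IsProbabilityMeasure (densityMeasure u) := by
  constructor
  rw [densityMeasure, withDensity_apply _ MeasurableSet.univ, Measure.restrict_univ,
    ← ofReal_integral_eq_lintegral_ofReal (integrable_of_continuous hu _)
      (Eventually.of_forall fun θ => (hpos θ).le), h1, ENNReal.ofReal_one]

theorem measure_eq_densityMeasure {u : S1 → ℝ} (hu : Continuous u)
    (hpos : ∀ θ, 0 < u θ) (h1 : ∫ θ, u θ = 1) {μ : Measure S1} [IsFiniteMeasure μ]
    (h : ∀ f : S1 → ℝ, Continuous f → ∫ θ, f θ ∂μ = ∫ θ, u θ * f θ) :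
    μ = densityMeasure u := by
  have := densityMeasure_isProbabilityMeasure hu hpos h1
  refine ext_of_forall_integral_eq_of_IsFiniteMeasure fun f => ?_
  rw [h f f.continuous, integral_densityMeasure hu hpos]

theorem isCk_zero_iff {f : S1 → ℝ} : IsCk 0 f ↔ Continuous f := by
  rw [IsCk, continuous_iff_lift, Nat.cast_zero, contDiff_zero]

theorem isCk_succ_iff {k : ℕ} {f : S1 → ℝ} :
    IsCk (k + 1) f ↔ (∀ x : ℝ, HasDerivAt (fun y : ℝ => f (y : S1)) (D f (x : S1)) x) ∧
      IsCk k (D f) := by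
  simp only [IsCk, D_coe, hasDerivAt_deriv_iff, Nat.cast_add, Nat.cast_one]
  rw [contDiff_succ_iff_deriv]
  simp [Differentiable]

theorem isCk_one_of_hasDerivAt {f g : S1 → ℝ} (hg : Continuous g)
    (h : ∀ x : ℝ, HasDerivAt (fun y : ℝ => f (y : S1)) (g (x : S1)) x) :
    IsCk 1 f ∧ ∀ θ, D f θ = g θ := by
  have hD : D f = g := funext <| forall_S1.2 fun x => by rw [D_coe, (h x).deriv]
  refine ⟨isCk_succ_iff.2 ⟨hD ▸ h, isCk_zero_iff.2 (hD ▸ hg)⟩, fun θ => by rw [hD]⟩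

theorem IsCk.continuous {k : ℕ} {f : S1 → ℝ} (h : IsCk k f) : Continuous f :=
  continuous_iff_lift.2 (ContDiff.continuous h)

theorem IsCk.hasDerivAt {k : ℕ} {f : S1 → ℝ} (h : IsCk (k + 1) f) (x : ℝ) :
    HasDerivAt (fun y : ℝ => f (y : S1)) (D f (x : S1)) x := (isCk_succ_iff.1 h).1 x

theorem IsCk.deriv {k : ℕ} {f : S1 → ℝ} (h : IsCk (k + 1) f) : IsCk k (D f) :=
  (isCk_succ_iff.1 h).2

theorem le_supNorm {f : S1 → ℝ} (hf : Continuous f) (θ : S1) : |f θ| ≤ supNorm f :=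
  le_ciSup (f := fun θ => |f θ|) (isCompact_range hf.abs).bddAbove θ

theorem supNorm_nonneg (f : S1 → ℝ) : 0 ≤ supNorm f :=
  Real.iSup_nonneg fun _ => abs_nonneg _

/-- Choosing the representative of `θ - η` of least absolute value realises the quotient distance on
the line, so Lipschitz bounds for lifts descend to the circle. -/
theorem exists_abs_sub_eq_dist (θ η : S1) :
    ∃ x y : ℝ, (x : S1) = θ ∧ (y : S1) = η ∧ |x - y| = dist θ η := by
  induction η using QuotientAddGroup.induction_on with
  | H y =>
    obtain ⟨t, ht, htn⟩ : ∃ t : ℝ, (t : S1) = θ - (y : S1) ∧ |t| = ‖θ - (y : S1)‖ := by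
      generalize θ - (y : S1) = ζ
      induction ζ using QuotientAddGroup.induction_on with
      | H z =>
        refine ⟨z - round ((2 * Real.pi)⁻¹ * z) * (2 * Real.pi), ?_, (AddCircle.norm_eq _).symm⟩
        rw [AddCircle.coe_sub, sub_eq_self, ← zsmul_eq_mul, AddCircle.coe_zsmul,
          AddCircle.coe_period, smul_zero]
    refine ⟨t + y, y, ?_, rfl, ?_⟩
    · rw [AddCircle.coe_add, ht]; exact sub_add_cancel _ _
    · rw [add_sub_cancel_right, htn, dist_eq_norm]

theorem dist_coe_le (x y : ℝ) : dist (x : S1) (y : S1) ≤ |x - y| := by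
  rw [dist_eq_norm, ← AddCircle.coe_sub]
  exact QuotientAddGroup.norm_mk_le_norm

theorem lipschitzWith_of_abs_deriv_le {f : S1 → ℝ} {f' : ℝ → ℝ} {C : ℝ≥0}
    (h : ∀ x : ℝ, HasDerivAt (fun y : ℝ => f (y : S1)) (f' x) x) (hC : ∀ x, |f' x| ≤ C) :
    LipschitzWith C f := by
  refine LipschitzWith.of_dist_le_mul fun θ η => ?_
  obtain ⟨x, y, rfl, rfl, hxy⟩ := exists_abs_sub_eq_dist θ η
  have := lipschitzWith_of_nnnorm_deriv_le (f := fun y : ℝ => f (y : S1)) (C := C)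
    (fun x => (h x).differentiableAt) (fun x => by
      rw [(h x).deriv, ← NNReal.coe_le_coe, coe_nnnorm]; exact hC x)
  rw [← hxy]
  exact this.dist_le_mul x y

/-! ### Scalar linear ODEs. -/

theorem hasDerivAt_integral {f : ℝ → ℝ} (hf : Continuous f) (x : ℝ) :
    HasDerivAt (fun y => ∫ t in (0 : ℝ)..y, f t) (f x) x :=
  intervalIntegral.integral_hasDerivAt_right (hf.intervalIntegrable _ _)
    (hf.stronglyMeasurableAtFilter _ _) hf.continuousAt

theorem exists_linear_ode_solution {p q : ℝ → ℝ} (hp : Continuous p) (hq : Continuous q) (c : ℝ) :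
    ∃ g : ℝ → ℝ, g 0 = c ∧ ∀ x, HasDerivAt g (p x * g x + q x) x := by
  set P : ℝ → ℝ := fun y => ∫ t in (0 : ℝ)..y, p t with hP
  have hP' : ∀ x, HasDerivAt P (p x) x := hasDerivAt_integral hp
  have hPc : Continuous P := continuous_iff_continuousAt.2 fun x => (hP' x).continuousAt
  have hk := hasDerivAt_integral (f := fun t => Real.exp (-P t) * q t) (by fun_prop)
  refine ⟨fun x => Real.exp (P x) * (c + ∫ t in (0 : ℝ)..x, Real.exp (-P t) * q t), ?_,
    fun x => ?_⟩
  · simp [hP]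
  · refine ((hP' x).exp.mul ((hk x).const_add c)).congr_deriv ?_
    have : Real.exp (P x) * Real.exp (-P x) = 1 := by rw [← Real.exp_add]; simp
    linear_combination q x * this

theorem linear_ode_solution_unique {p q : ℝ → ℝ} (hp : Continuous p) {g k : ℝ → ℝ}
    (hg : ∀ x, HasDerivAt g (p x * g x + q x) x) (hk : ∀ x, HasDerivAt k (p x * k x + q x) x)
    {x₀ : ℝ} (h0 : g x₀ = k x₀) : g = k := by
  have hP' := hasDerivAt_integral hp
  set P : ℝ → ℝ := fun y => ∫ t in (0 : ℝ)..y, p t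
  have hd : ∀ x, HasDerivAt (fun x => Real.exp (-P x) * (g x - k x)) 0 x := fun x => by
    refine ((hP' x).neg.exp.mul ((hg x).sub (hk x))).congr_deriv ?_
    simp only [Pi.neg_apply, Pi.sub_apply]
    ring
  funext x
  have := is_const_of_deriv_eq_zero (fun x => (hd x).differentiableAt) (fun x => (hd x).deriv) x x₀
  simp only [h0, sub_self, mul_zero, mul_eq_zero, Real.exp_ne_zero, false_or] at this
  exact sub_eq_zero.1 this

/-- The translate by `T` solves the same equation with the same value at `0`, so uniqueness applies.
-/
theorem linear_ode_solution_periodic {p q : ℝ → ℝ} {T : ℝ} (hp : Continuous p)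
    (hpT : ∀ x, p (x + T) = p x) (hqT : ∀ x, q (x + T) = q x) {g : ℝ → ℝ}
    (hg : ∀ x, HasDerivAt g (p x * g x + q x) x) (h0 : g T = g 0) (x : ℝ) :
    g (x + T) = g x := by
  refine congrFun (linear_ode_solution_unique hp (g := fun x => g (x + T)) (x₀ := 0)
    (fun x => ?_) hg (by simpa using h0)) x
  have := (hg (x + T)).comp_add_const x T
  rwa [hpT, hqT] at this

/-! ### The constant-flux equation: existence and duality with the generator. -/

/-- The stationary Fokker--Planck equation `a u' = h u - J` with constant flux `J`. -/
noncomputable def IsFluxSolution (a h u : S1 → ℝ) (J : ℝ) : Prop :=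
  ∀ x : ℝ, HasDerivAt (fun y : ℝ => u (y : S1))
    ((h (x : S1) * u (x : S1) - J) / a (x : S1)) x

theorem exists_isFluxSolution {a h : S1 → ℝ} (ha : Continuous a) (hpos : ∀ θ, 0 < a θ)
    (hh : Continuous h) :
    ∃ (u : C(S1, ℝ)) (J : ℝ), (∀ θ, 0 < u θ) ∧ ∫ θ, u θ = 1 ∧ IsFluxSolution a h u J := by
  have hT := Real.two_pi_pos
  have ha' := continuous_iff_lift.1 ha
  have hh' := continuous_iff_lift.1 hh
  have hane : ∀ x : ℝ, a (x : S1) ≠ 0 := fun x => (hpos x).ne'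
  have hpc : Continuous fun x : ℝ => h (x : S1) / a (x : S1) := hh'.div ha' hane
  have hqc : Continuous fun x : ℝ => (a (x : S1))⁻¹ := ha'.inv₀ hane
  have hP' := hasDerivAt_integral hpc
  set P : ℝ → ℝ := fun y => ∫ t in (0 : ℝ)..y, h (t : S1) / a (t : S1) with hP
  have hPc : Continuous P := continuous_iff_continuousAt.2 fun x => (hP' x).continuousAt
  have hk := hasDerivAt_integral (f := fun t => Real.exp (-P t) * (a (t : S1))⁻¹) (by fun_prop)
  set k : ℝ → ℝ := fun x => ∫ t in (0 : ℝ)..x, Real.exp (-P t) * (a (t : S1))⁻¹ with hkdef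
  have hmono : StrictMono k := strictMono_of_hasDerivAt_pos hk fun x =>
    mul_pos (Real.exp_pos _) (inv_pos.2 (hpos _))
  have hk0 : k 0 = 0 := by simp [hkdef]
  have hkT : 0 < k (2 * Real.pi) := hk0 ▸ hmono hT
  -- The unique flux for which the solution `v` below, with `v 0 = 1`, returns to `1` at `2π`.
  set J : ℝ := (1 - Real.exp (-P (2 * Real.pi))) / k (2 * Real.pi) with hJ
  have hJk : J * k (2 * Real.pi) = 1 - Real.exp (-P (2 * Real.pi)) := div_mul_cancel₀ _ hkT.ne'
  set v : ℝ → ℝ := fun x => Real.exp (P x) * (1 - J * k x) with hv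
  have hexp : ∀ x, Real.exp (P x) * Real.exp (-P x) = 1 := fun x => by
    rw [← Real.exp_add]; simp
  have hv' : ∀ x : ℝ, HasDerivAt v (h (x : S1) / a (x : S1) * v x + -J * (a (x : S1))⁻¹) x :=
    fun x => by
      refine ((hP' x).exp.mul (((hk x).const_mul J).const_sub 1)).congr_deriv ?_
      linear_combination (-J * (a (x : S1))⁻¹) * hexp x
  have hper : ∀ x, v (x + 2 * Real.pi) = v x := by
    refine linear_ode_solution_periodic hpc (fun x => ?_) (fun x => ?_) hv' ?_
    · simp only [coe_add_two_pi]
    · simp only [coe_add_two_pi]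
    · simp only [hv, hJk, hk0]
      rw [sub_sub_cancel, hexp]
      simp [hP]
  have hvc : Continuous v := continuous_iff_continuousAt.2 fun x => (hv' x).continuousAt
  have hvpos : ∀ x, 0 < v x := fun x => by
    obtain ⟨y, hy, hxy⟩ := Function.Periodic.exists_mem_Ico₀ (f := v) hper hT x
    rw [hxy]
    refine mul_pos (Real.exp_pos _) ?_
    have h0 : 0 ≤ k y := hk0 ▸ hmono.monotone hy.1
    have h1 : k y ≤ k (2 * Real.pi) := hmono.monotone hy.2.le
    have h2 := Real.exp_pos (-P (2 * Real.pi))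
    -- As `k` increases, `1 - J k` stays between its endpoint values `1` and `exp (-P (2π))`, both
    -- positive.
    rcases le_total J 0 with hJ0 | hJ0
    · nlinarith
    · nlinarith [mul_le_mul_of_nonneg_left h1 hJ0]
  obtain ⟨w, hw⟩ := exists_continuousMap hper hvc
  have hI : 0 < ∫ θ, w θ := by
    rw [integral_eq_interval_zero]
    exact intervalIntegral.intervalIntegral_pos_of_pos
      ((continuous_iff_lift.1 w.continuous).intervalIntegrable _ _)
      (fun x => by rw [hw]; exact hvpos x) hT
  refine ⟨(∫ θ, w θ)⁻¹ • w, (∫ θ, w θ)⁻¹ * J, forall_S1.2 fun x => ?_, ?_, fun x => ?_⟩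
  · simpa only [ContinuousMap.smul_apply, smul_eq_mul, hw] using mul_pos (inv_pos.2 hI) (hvpos x)
  · simp only [ContinuousMap.smul_apply, smul_eq_mul]
    rw [integral_const_mul, inv_mul_cancel₀ hI.ne']
  · simp only [ContinuousMap.smul_apply, smul_eq_mul, hw]
    refine ((hv' x).const_mul (∫ θ, w θ)⁻¹).congr_deriv ?_
    ring

/-- The pairing of a flux solution with the operator `g ↦ a g' + (h + a') g`. -/
theorem IsFluxSolution.integral_pairing {a a' h u : S1 → ℝ} {J : ℝ}
    (hpos : ∀ θ, 0 < a θ) (ha' : Continuous a') (hh : Continuous h) (hu : Continuous u)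
    (ha : ∀ x : ℝ, HasDerivAt (fun y : ℝ => a (y : S1)) (a' (x : S1)) x)
    (hflux : IsFluxSolution a h u J) {g g' : ℝ → ℝ} (hg : ∀ x, HasDerivAt g (g' x) x)
    (hg' : Continuous g') :
    ∫ x in (0 : ℝ)..2 * Real.pi, u (x : S1) * (a (x : S1) * g' x
      + (h (x : S1) + a' (x : S1)) * g x) =
      u 0 * a 0 * (g (2 * Real.pi) - g 0) + J * ∫ x in (0 : ℝ)..2 * Real.pi, g x := by
  have hac : Continuous fun x : ℝ => a (x : S1) :=
    continuous_iff_continuousAt.2 fun x => (ha x).continuousAt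
  have hgc : Continuous g := continuous_iff_continuousAt.2 fun x => (hg x).continuousAt
  have ha'c := continuous_iff_lift.1 ha'
  have hhc := continuous_iff_lift.1 hh
  have huc := continuous_iff_lift.1 hu
  have hdc : Continuous fun x : ℝ => u (x : S1) * (a (x : S1) * g' x
      + (h (x : S1) + a' (x : S1)) * g x) :=
    huc.mul ((hac.mul hg').add ((hhc.add ha'c).mul hgc))
  -- The flux equation replaces `a u'` by `h u - J` in `(u a g)'`. Only `u` and `a` are periodic
  -- here: `g` may have a jump over a period, which is why the boundary term is kept.
  have hF : ∀ x : ℝ, HasDerivAt (fun y : ℝ => u (y : S1) * a (y : S1) * g y)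
      (u (x : S1) * (a (x : S1) * g' x + (h (x : S1) + a' (x : S1)) * g x) - J * g x) x :=
    fun x => by
      refine (((hflux x).mul (ha x)).mul (hg x)).congr_deriv ?_
      have := (hpos (x : S1)).ne'
      simp only [Pi.mul_apply]
      field_simp
      ring
  have h1 := intervalIntegral.integral_eq_sub_of_hasDerivAt (a := 0) (b := 2 * Real.pi)
    (fun x _ => hF x) ((hdc.sub (hgc.const_mul J)).intervalIntegrable _ _)
  rw [intervalIntegral.integral_sub (hdc.intervalIntegrable _ _)
    ((hgc.const_mul J).intervalIntegrable _ _), intervalIntegral.integral_const_mul] at h1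
  have h2 : ((2 * Real.pi : ℝ) : S1) = 0 := AddCircle.coe_period _
  rw [h2, AddCircle.coe_zero] at h1
  linear_combination h1

theorem IsCk.deriv_integral_eq_zero {f : S1 → ℝ} (hf : IsCk 1 f) :
    ∫ x in (0 : ℝ)..2 * Real.pi, D f (x : S1) = 0 := by
  rw [intervalIntegral.integral_eq_sub_of_hasDerivAt (fun x _ => hf.hasDerivAt x)
    ((continuous_iff_lift.1 hf.deriv.continuous).intervalIntegrable _ _)]
  have h2 : ((2 * Real.pi : ℝ) : S1) = 0 := AddCircle.coe_period _
  rw [h2, AddCircle.coe_zero, sub_self]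

theorem IsFluxSolution.integral_eq_zero {a a' h u : S1 → ℝ} {J : ℝ}
    (hpos : ∀ θ, 0 < a θ) (ha' : Continuous a') (hh : Continuous h) (hu : Continuous u)
    (ha : ∀ x : ℝ, HasDerivAt (fun y : ℝ => a (y : S1)) (a' (x : S1)) x)
    (hflux : IsFluxSolution a h u J) {f : S1 → ℝ} (hf : IsCk 2 f) :
    ∫ θ, u θ * (a θ * D (D f) θ + (h θ + a' θ) * D f θ) = 0 := by
  rw [integral_eq_interval_zero]
  have := hflux.integral_pairing hpos ha' hh hu ha (g := fun x : ℝ => D f (x : S1))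
    (fun x => (hf.deriv).hasDerivAt x) (continuous_iff_lift.1 hf.deriv.deriv.continuous)
  rw [this, (show IsCk 1 f from ContDiff.of_le hf (by norm_num)).deriv_integral_eq_zero]
  have h2 : ((2 * Real.pi : ℝ) : S1) = 0 := AddCircle.coe_period _
  rw [h2, AddCircle.coe_zero]
  ring

/-- This is a first-order equation for `g = f'`, with one free constant but two conditions: `g`
periodic, and of mean zero so that its primitive is periodic. The constant is spent on the mean;
periodicity then follows from the pairing with `u`, since `∫ u φ = 0` kills everything but `u(0)
a(0) (g(2π) - g(0))`. -/
theorem IsFluxSolution.exists_poisson_solution {a a' h u φ : S1 → ℝ} {J : ℝ}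
    (hpos : ∀ θ, 0 < a θ) (ha' : Continuous a') (hh : Continuous h) (hu : Continuous u)
    (ha : ∀ x : ℝ, HasDerivAt (fun y : ℝ => a (y : S1)) (a' (x : S1)) x)
    (hflux : IsFluxSolution a h u J) (hupos : ∀ θ, 0 < u θ) (hφ : Continuous φ)
    (hφ0 : ∫ θ, u θ * φ θ = 0) :
    ∃ f : S1 → ℝ, IsCk 2 f ∧ ∀ θ, a θ * D (D f) θ + (h θ + a' θ) * D f θ = φ θ := by
  have hT := Real.two_pi_pos
  have hac : Continuous fun x : ℝ => a (x : S1) :=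
    continuous_iff_continuousAt.2 fun x => (ha x).continuousAt
  have hane : ∀ x : ℝ, a (x : S1) ≠ 0 := fun x => (hpos x).ne'
  have ha'c := continuous_iff_lift.1 ha'
  have hhc := continuous_iff_lift.1 hh
  have hφc := continuous_iff_lift.1 hφ
  set p : ℝ → ℝ := fun x => -(h (x : S1) + a' (x : S1)) / a (x : S1) with hp
  set q : ℝ → ℝ := fun x => φ (x : S1) / a (x : S1) with hq
  have hpc : Continuous p := (hhc.add ha'c).neg.div hac hane
  have hqc : Continuous q := hφc.div hac hane
  obtain ⟨w, -, hw⟩ := exists_linear_ode_solution hpc hqc 0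
  obtain ⟨g, hgint, hg⟩ : ∃ g : ℝ → ℝ, ∫ x in (0 : ℝ)..2 * Real.pi, g x = 0 ∧
      ∀ x, HasDerivAt g (p x * g x + q x) x := by
    have hP' := hasDerivAt_integral hpc
    set P : ℝ → ℝ := fun y => ∫ t in (0 : ℝ)..y, p t with hP
    have hPc : Continuous P := continuous_iff_continuousAt.2 fun x => (hP' x).continuousAt
    have hwc : Continuous w := continuous_iff_continuousAt.2 fun x => (hw x).continuousAt
    have hE : 0 < ∫ x in (0 : ℝ)..2 * Real.pi, Real.exp (P x) :=
      intervalIntegral.intervalIntegral_pos_of_pos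
        (Continuous.intervalIntegrable (by fun_prop) _ _) (fun x => Real.exp_pos _) hT
    set E := ∫ x in (0 : ℝ)..2 * Real.pi, Real.exp (P x)
    -- Subtract the multiple of the homogeneous solution `exp P` that cancels the mean.
    refine ⟨fun x => w x - (∫ x in (0 : ℝ)..2 * Real.pi, w x) / E * Real.exp (P x), ?_,
      fun x => ?_⟩
    · rw [intervalIntegral.integral_sub (hwc.intervalIntegrable _ _)
        (Continuous.intervalIntegrable (by fun_prop) _ _), intervalIntegral.integral_const_mul,
        div_mul_cancel₀ _ hE.ne', sub_self]
    · refine ((hw x).sub ((hP' x).exp.const_mul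
        ((∫ x in (0 : ℝ)..2 * Real.pi, w x) / E))).congr_deriv ?_
      ring
  have hgc : Continuous g := continuous_iff_continuousAt.2 fun x => (hg x).continuousAt
  have hper : ∀ x, g (x + 2 * Real.pi) = g x := by
    refine linear_ode_solution_periodic hpc (fun x => ?_) (fun x => ?_) hg ?_
    · simp only [hp, coe_add_two_pi]
    · simp only [hq, coe_add_two_pi]
    · have h1 := hflux.integral_pairing hpos ha' hh hu ha hg (by fun_prop)
      have h2 : ∀ x : ℝ, a (x : S1) * (p x * g x + q x) + (h (x : S1) + a' (x : S1)) * g x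
          = φ (x : S1) := fun x => by
        have := hane x
        simp only [hp, hq]
        field_simp
        ring
      simp only [h2] at h1
      rw [← integral_eq_interval_zero (fun θ => u θ * φ θ), hφ0, hgint, mul_zero, add_zero] at h1
      have := mul_pos (hupos 0) (hpos 0)
      rcases mul_eq_zero.1 h1.symm with h | h
      · exact absurd h this.ne'
      · exact sub_eq_zero.1 h
  have hf' := hasDerivAt_integral hgc
  obtain ⟨f, hf⟩ := exists_lift (g := fun y => ∫ t in (0 : ℝ)..y, g t) fun x => by
    rw [← intervalIntegral.integral_add_adjacent_intervals (hgc.intervalIntegrable 0 x)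
      (hgc.intervalIntegrable x _),
      Function.Periodic.intervalIntegral_add_eq (f := g) hper x 0, zero_add, hgint, add_zero]
  obtain ⟨g₁, hg₁⟩ := exists_continuousMap hper hgc
  obtain ⟨g₂, hg₂⟩ := exists_continuousMap (g := fun x => p x * g x + q x)
    (fun x => by simp only [hp, hq, coe_add_two_pi, hper]) (by fun_prop)
  have k1 := isCk_one_of_hasDerivAt (f := f) (g := g₁) g₁.continuous fun x => by
    simpa only [hf, hg₁] using hf' x
  have k2 := isCk_one_of_hasDerivAt (f := g₁) (g := g₂) g₂.continuous fun x => by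
    simpa only [hg₁, hg₂] using hg x
  have hD : D f = g₁ := funext k1.2
  have hDD : D g₁ = g₂ := funext k2.2
  refine ⟨f, isCk_succ_iff.2 ⟨(isCk_succ_iff.1 k1.1).1, hD ▸ k2.1⟩, forall_S1.2 fun x => ?_⟩
  rw [hD, hDD, hg₁, hg₂]
  have := hane x
  simp only [hp, hq]
  field_simp
  ring

/-! ### The generator in terms of the flux coefficients, and its stationary measures. -/

/-- The diffusion coefficient `ε²/2 ∑ Aᵢ²` of the perturbed equation. -/
noncomputable def diffusion {m : ℕ} (ε : ℝ) (A : Fin m → S1 → ℝ) (θ : S1) : ℝ := ε ^ 2 / 2 * ∑ i, A i θ ^ 2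

/-- The derivative of the diffusion coefficient. -/
noncomputable def diffusionDeriv {m : ℕ} (ε : ℝ) (A : Fin m → S1 → ℝ) (θ : S1) : ℝ :=
  ε ^ 2 * ∑ i, A i θ * D (A i) θ

/-- The coefficient `h` of the flux equation `a u' = h u - J`. -/
noncomputable def fluxCoeff {m : ℕ} (B : S1 → ℝ) (ε : ℝ) (A₀ : S1 → ℝ) (A : Fin m → S1 → ℝ) (θ : S1) : ℝ :=
  B θ + (ε ^ 2 * A₀ θ - diffusionDeriv ε A θ / 2)

section Coefficients

variable {m : ℕ} {ε : ℝ} {B A₀ : S1 → ℝ} {A : Fin m → S1 → ℝ}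

theorem hasDerivAt_diffusion (hA : ∀ i, IsCk 1 (A i)) (x : ℝ) :
    HasDerivAt (fun y : ℝ => diffusion ε A (y : S1)) (diffusionDeriv ε A (x : S1)) x := by
  unfold diffusion diffusionDeriv
  have : ∀ i ∈ Finset.univ, HasDerivAt (fun y : ℝ => A i (y : S1) ^ 2)
      (2 * (A i (x : S1) * D (A i) (x : S1))) x := fun i _ => by
    refine (((hA i).hasDerivAt x).pow 2).congr_deriv ?_
    push_cast
    ring
  refine ((HasDerivAt.fun_sum this).const_mul (ε ^ 2 / 2)).congr_deriv ?_
  rw [← Finset.mul_sum]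
  ring

theorem continuous_diffusion (hA : ∀ i, IsCk 1 (A i)) : Continuous (diffusion ε A) := by
  have := fun i => (hA i).continuous
  unfold diffusion
  fun_prop

theorem continuous_diffusionDeriv (hA : ∀ i, IsCk 1 (A i)) : Continuous (diffusionDeriv ε A) := by
  have := fun i => (hA i).continuous
  have := fun i => (hA i).deriv.continuous
  unfold diffusionDeriv
  fun_prop

theorem continuous_fluxCoeff (hB : Continuous B) (hA₀ : Continuous A₀) (hA : ∀ i, IsCk 1 (A i)) :
    Continuous (fluxCoeff B ε A₀ A) := by
  have := continuous_diffusionDeriv (ε := ε) hA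
  unfold fluxCoeff
  fun_prop

theorem diffusion_pos (hε : 0 < ε) (hnd : ∀ θ, 0 < ∑ i, A i θ ^ 2) (θ : S1) :
    0 < diffusion ε A θ :=
  mul_pos (by positivity) (hnd θ)

theorem generator_eq (hA : ∀ i, IsCk 1 (A i)) {f : S1 → ℝ} (hf : IsCk 2 f) (θ : S1) :
    generator (drift B ε A₀) (noise ε A) f θ = diffusion ε A θ * D (D f) θ
      + (fluxCoeff B ε A₀ A θ + diffusionDeriv ε A θ) * D f θ := by
  revert θ
  refine forall_S1.2 fun x => ?_
  have key : ∀ i, D (vf (noise ε A i) f) (x : S1) = ε * (D (A i) (x : S1) * D f (x : S1) +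
      A i (x : S1) * D (D f) (x : S1)) := fun i => by
    rw [D_coe]
    refine HasDerivAt.deriv ?_
    simp only [vf, noise, mul_assoc]
    exact (((hA i).hasDerivAt x).mul (hf.deriv.hasDerivAt x)).const_mul ε
  have h1 : ∑ i, vf (noise ε A i) (vf (noise ε A i) f) (x : S1) =
      ε ^ 2 * ((∑ i, A i (x : S1) * D (A i) (x : S1)) * D f (x : S1)
        + (∑ i, A i (x : S1) ^ 2) * D (D f) (x : S1)) := by
    rw [Finset.sum_mul, Finset.sum_mul, ← Finset.sum_add_distrib, Finset.mul_sum]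
    refine Finset.sum_congr rfl fun i _ => ?_
    rw [vf, key, noise]
    ring
  rw [generator, h1]
  simp only [vf, drift, fluxCoeff, diffusion, diffusionDeriv]
  ring

theorem D_const_mul (c : ℝ) {f : S1 → ℝ} (hf : IsCk 1 f) (θ : S1) :
    D (fun θ => c * f θ) θ = c * D f θ := by
  revert θ
  refine forall_S1.2 fun x => ?_
  rw [D_coe]
  exact ((hf.hasDerivAt x).const_mul c).deriv

/-- Stationary measures are exactly the measures with the density given by the flux equation. -/
theorem isStationaryMeasure_iff (hB : Continuous B) (hA₀ : Continuous A₀)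
    (hA : ∀ i, IsCk 1 (A i)) (hε : 0 < ε) (hnd : ∀ θ, 0 < ∑ i, A i θ ^ 2) {u : S1 → ℝ} {J : ℝ}
    (hu : Continuous u) (hupos : ∀ θ, 0 < u θ) (hu1 : ∫ θ, u θ = 1)
    (hflux : IsFluxSolution (diffusion ε A) (fluxCoeff B ε A₀ A) u J) (μ : Measure S1) :
    IsStationaryMeasure (drift B ε A₀) (noise ε A) μ ↔ μ = densityMeasure u := by
  have hh := continuous_fluxCoeff (ε := ε) hB hA₀ hA
  have ha' := continuous_diffusionDeriv (ε := ε) hA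
  have hpos := diffusion_pos hε hnd
  constructor
  · rintro ⟨hμ, -, -, hL⟩
    refine measure_eq_densityMeasure hu hupos hu1 fun f hf => ?_
    -- Centring `f` by its `u`-mean makes it a value `L k` of the generator; stationarity then says
    -- that `μ` gives `f` the same mean as `u` does.
    obtain ⟨k, hk, hkL⟩ := hflux.exists_poisson_solution hpos ha' hh hu (hasDerivAt_diffusion hA)
      hupos (φ := fun θ => f θ - ∫ θ, u θ * f θ) (by fun_prop) (by
        simp only [mul_sub]
        rw [integral_sub (integrable_of_continuous (by fun_prop) _)
          (integrable_of_continuous (by fun_prop) _), integral_mul_const, hu1, one_mul, sub_self])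
    have := hL k hk
    simp only [generator_eq hA hk, hkL] at this
    rw [integral_sub (integrable_of_continuous hf _) (integrable_const _)] at this
    simpa [sub_eq_zero] using this
  · rintro rfl
    have hprob := densityMeasure_isProbabilityMeasure hu hupos hu1
    refine ⟨hprob, integrable_of_continuous ?_ _, fun i => integrable_of_continuous ?_ _,
      fun f hf => ?_⟩
    · unfold drift; fun_prop
    · have : D (noise ε A i) = fun θ => ε * D (A i) θ := funext (D_const_mul ε (hA i))
      rw [this]
      exact continuous_const.mul (hA i).deriv.continuous
    · simp only [generator_eq hA hf]
      rw [integral_densityMeasure hu hupos]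
      exact hflux.integral_eq_zero hpos ha' hh hu (hasDerivAt_diffusion hA) hf

end Coefficients

/-! ### Maximum principle estimates independent of the ellipticity. -/

theorem exists_forall_le {f : S1 → ℝ} (hf : Continuous f) : ∃ x : ℝ, ∀ θ, f θ ≤ f (x : S1) := by
  obtain ⟨θ, -, hθ⟩ := isCompact_univ.exists_isMaxOn Set.univ_nonempty hf.continuousOn
  obtain ⟨x, rfl⟩ := QuotientAddGroup.mk_surjective θ
  exact ⟨x, fun θ => hθ (Set.mem_univ θ)⟩

theorem exists_forall_ge {f : S1 → ℝ} (hf : Continuous f) : ∃ x : ℝ, ∀ θ, f (x : S1) ≤ f θ := by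
  obtain ⟨x, hx⟩ := exists_forall_le hf.neg
  exact ⟨x, fun θ => neg_le_neg_iff.1 (hx θ)⟩

theorem deriv_le_of_forall_gt {f : ℝ → ℝ} {c k x : ℝ} (hf : HasDerivAt f c x)
    (h : ∀ y > x, f y - f x ≤ k * (y - x)) : c ≤ k := by
  have h1 := (hasDerivAt_iff_tendsto_slope.1 hf).mono_left
    (nhdsWithin_mono x fun y (hy : y ∈ Set.Ioi x) => (ne_of_gt hy : y ≠ x))
  refine le_of_tendsto h1 (eventually_mem_nhdsWithin.mono fun y (hy : x < y) => ?_)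
  rw [slope_def_field, div_le_iff₀ (sub_pos.2 hy)]
  exact h y hy

theorem neg_le_deriv_of_forall_lt {f : ℝ → ℝ} {c k x : ℝ} (hf : HasDerivAt f c x)
    (h : ∀ y < x, f y - f x ≤ k * (x - y)) : -k ≤ c := by
  have h1 := (hasDerivAt_iff_tendsto_slope.1 hf).mono_left
    (nhdsWithin_mono x fun y (hy : y ∈ Set.Iio x) => (ne_of_lt hy : y ≠ x))
  refine ge_of_tendsto h1 (eventually_mem_nhdsWithin.mono fun y (hy : y < x) => ?_)
  rw [slope_def_field, le_div_iff_of_neg (sub_neg.2 hy)]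
  linarith [h y hy]

/-- At a maximum of `u - f` with `f` Lipschitz, the derivative of `u` is bounded by the Lipschitz
constant of `f`. -/
theorem abs_deriv_le_of_isMax {u f : S1 → ℝ} {K : ℝ≥0} (hf : LipschitzWith K f) {c x : ℝ}
    (hu : HasDerivAt (fun y : ℝ => u (y : S1)) c x)
    (hmax : ∀ θ, u θ - f θ ≤ u (x : S1) - f (x : S1)) : |c| ≤ K := by
  have key : ∀ y : ℝ, u (y : S1) - u (x : S1) ≤ K * |y - x| := fun y => by
    have h1 := hf.dist_le_mul (y : S1) (x : S1)
    rw [Real.dist_eq] at h1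
    have h2 := mul_le_mul_of_nonneg_left (dist_coe_le y x) K.2
    have h3 := le_abs_self (f (y : S1) - f (x : S1))
    have h4 := hmax (y : S1)
    simp only [NNReal.val_eq_coe] at h2
    linarith
  refine abs_le.2 ⟨neg_le_deriv_of_forall_lt hu fun y hy => ?_,
    deriv_le_of_forall_gt hu fun y hy => ?_⟩
  · have := key y
    rwa [abs_of_neg (sub_neg.2 hy), neg_sub] at this
  · have := key y
    rwa [abs_of_pos (sub_pos.2 hy)] at this

namespace IsFluxSolution

variable {a h u : S1 → ℝ} {J : ℝ}

theorem continuous (hflux : IsFluxSolution a h u J) : Continuous u :=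
  continuous_iff_lift.2 (continuous_iff_continuousAt.2 fun x => (hflux x).continuousAt)

theorem neg (hflux : IsFluxSolution a h u J) : IsFluxSolution a h (fun θ => -u θ) (-J) :=
  fun x => (hflux x).neg.congr_deriv (by ring)

/-- The comparison function need not be differentiable, which matters because `B`, and so `J / B`,
is only Lipschitz. The derivative bound at the maximum is multiplied by `a`, so the defect `h u - J`
is as small as `a`. -/
theorem exists_max_sub (hflux : IsFluxSolution a h u J) (hpos : ∀ θ, 0 < a θ) {f : S1 → ℝ}
    {K : ℝ≥0} (hf : LipschitzWith K f) :
    ∃ x : ℝ, (∀ θ, u θ - f θ ≤ u (x : S1) - f (x : S1)) ∧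
      |h (x : S1) * u (x : S1) - J| ≤ a (x : S1) * K := by
  obtain ⟨x, hx⟩ := exists_forall_le (hflux.continuous.sub hf.continuous)
  refine ⟨x, hx, ?_⟩
  have := abs_deriv_le_of_isMax hf (hflux x) hx
  rwa [abs_div, abs_of_pos (hpos _), div_le_iff₀ (hpos _), mul_comm (K : ℝ)] at this

theorem exists_min_sub (hflux : IsFluxSolution a h u J) (hpos : ∀ θ, 0 < a θ) {f : S1 → ℝ}
    {K : ℝ≥0} (hf : LipschitzWith K f) :
    ∃ x : ℝ, (∀ θ, u (x : S1) - f (x : S1) ≤ u θ - f θ) ∧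
      |h (x : S1) * u (x : S1) - J| ≤ a (x : S1) * K := by
  obtain ⟨x, hx, hx'⟩ := hflux.neg.exists_max_sub hpos (f := fun θ => -f θ) hf.neg
  refine ⟨x, fun θ => by linarith [hx θ], ?_⟩
  rw [← abs_neg]
  convert hx' using 2
  ring

end IsFluxSolution

theorem integral_const_S1 (c : ℝ) : ∫ _ : S1, c = 2 * Real.pi * c := by
  rw [integral_eq_interval_zero, intervalIntegral.integral_const, sub_zero, smul_eq_mul]

theorem integral_le_two_pi_mul {f : S1 → ℝ} (hf : Continuous f) {c : ℝ} (h : ∀ θ, f θ ≤ c) :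
    ∫ θ, f θ ≤ 2 * Real.pi * c := by
  rw [← integral_const_S1]
  exact integral_mono (integrable_of_continuous hf _) (integrable_const _) h

theorem two_pi_mul_le_integral {f : S1 → ℝ} (hf : Continuous f) {c : ℝ} (h : ∀ θ, c ≤ f θ) :
    2 * Real.pi * c ≤ ∫ θ, f θ := by
  rw [← integral_const_S1]
  exact integral_mono (integrable_const _) (integrable_of_continuous hf _) h

/-- At the extrema of `u` the flux equation reads `h u = J`, so `m max u ≤ J ≤ M min u`; unit mass
gives `2π min u ≤ 1 ≤ 2π max u`. -/
theorem IsFluxSolution.bounds {a h u : S1 → ℝ} {J m M : ℝ} (hflux : IsFluxSolution a h u J)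
    (hpos : ∀ θ, 0 < a θ) (hupos : ∀ θ, 0 < u θ) (hu1 : ∫ θ, u θ = 1) (hm : 0 < m)
    (hhm : ∀ θ, m ≤ h θ) (hhM : ∀ θ, h θ ≤ M) :
    (0 < J ∧ 2 * Real.pi * J ≤ M) ∧ ∀ θ, m / (2 * Real.pi * M) ≤ u θ ∧
      u θ ≤ M / (2 * Real.pi * m) := by
  have hT := Real.two_pi_pos
  have hM : 0 < M := hm.trans_le ((hhm 0).trans (hhM 0))
  -- Comparison with the zero function, whose Lipschitz constant is `0`, gives exact equality at the
  -- extrema.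
  obtain ⟨x, hx, hx'⟩ := hflux.exists_max_sub hpos (LipschitzWith.const (0 : ℝ))
  obtain ⟨y, hy, hy'⟩ := hflux.exists_min_sub hpos (LipschitzWith.const (0 : ℝ))
  simp only [sub_zero, NNReal.coe_zero, mul_zero, abs_nonpos_iff, sub_eq_zero] at hx hx' hy hy'
  have h1 := integral_le_two_pi_mul hflux.continuous hx
  have h2 := two_pi_mul_le_integral hflux.continuous hy
  rw [hu1] at h1 h2
  have hux := hupos (x : S1)
  have huy := hupos (y : S1)
  have hJ1 : m * u (x : S1) ≤ J := hx' ▸ mul_le_mul_of_nonneg_right (hhm _) hux.le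
  have hJ2 : J ≤ M * u (y : S1) := hy' ▸ mul_le_mul_of_nonneg_right (hhM _) huy.le
  have hJ3 : 2 * Real.pi * J ≤ M := by
    nlinarith [mul_le_mul_of_nonneg_left hJ2 hT.le, mul_le_mul_of_nonneg_left h2 hM.le]
  have hJ4 : m ≤ 2 * Real.pi * J := by
    nlinarith [mul_le_mul_of_nonneg_left hJ1 hT.le, mul_le_mul_of_nonneg_left h1 hm.le]
  refine ⟨⟨by nlinarith [mul_pos hm hux], hJ3⟩, fun θ => ⟨?_, ?_⟩⟩
  · rw [div_le_iff₀ (by positivity)]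
    nlinarith [mul_le_mul_of_nonneg_left (hy θ) (mul_pos hT hM).le,
      mul_le_mul_of_nonneg_left hJ2 hT.le]
  · rw [le_div_iff₀ (by positivity)]
    nlinarith [mul_le_mul_of_nonneg_left (hx θ) (mul_pos hT hm).le,
      mul_le_mul_of_nonneg_left hJ1 hT.le]

theorem lipschitzWith_const_div {B : S1 → ℝ} {L : ℝ≥0} (hB : LipschitzWith L B) {b J : ℝ≥0}
    (hb : 0 < b) (hbB : ∀ θ, (b : ℝ) ≤ B θ) :
    LipschitzWith (J * L / b ^ 2) fun θ => (J : ℝ) / B θ := by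
  have hb' : (0 : ℝ) < b := hb
  refine LipschitzWith.of_dist_le_mul fun θ η => ?_
  have h1 := hB.dist_le_mul η θ
  have hθ := hb'.trans_le (hbB θ)
  have hη := hb'.trans_le (hbB η)
  rw [Real.dist_eq] at h1 ⊢
  rw [div_sub_div _ _ hθ.ne' hη.ne', abs_div, abs_of_pos (mul_pos hθ hη),
    show (J : ℝ) * B η - B θ * J = J * (B η - B θ) by ring, abs_mul,
    abs_of_nonneg J.coe_nonneg]
  push_cast
  rw [div_mul_eq_mul_div, sq, mul_assoc, dist_comm θ]
  have hd : 0 ≤ dist η θ := dist_nonneg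
  exact div_le_div₀ (by positivity) (mul_le_mul_of_nonneg_left h1 J.2) (by positivity)
    (mul_le_mul (hbB θ) (hbB η) hb'.le hθ.le)

/-- Uniform bounds for flux solutions and a rate of uniform convergence to `γ / B`. -/
theorem exists_uniform_bounds {B : S1 → ℝ} {L : ℝ≥0} (hB : LipschitzWith L B)
    (hBpos : ∀ θ, 0 < B θ) :
    ∃ c C K η₀ : ℝ, 0 < c ∧ 0 < C ∧ 0 ≤ K ∧ 0 < η₀ ∧ ∀ (a h u : S1 → ℝ) (J η : ℝ), η ≤ η₀ →
      IsFluxSolution a h u J → (∀ θ, 0 < a θ ∧ a θ ≤ η) → (∀ θ, |h θ - B θ| ≤ η) →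
      (∀ θ, 0 < u θ) → ∫ θ, u θ = 1 →
      (∀ θ, c ≤ u θ ∧ u θ ≤ C ∧ c ≤ h θ - η) ∧
        ∀ θ, |u θ - (∫ θ, (B θ)⁻¹)⁻¹ / B θ| ≤ K * η := by
  have hT := Real.two_pi_pos
  obtain ⟨x₁, hx₁⟩ := exists_forall_ge hB.continuous
  obtain ⟨x₂, hx₂⟩ := exists_forall_le hB.continuous
  obtain ⟨b, hb⟩ : ∃ b : ℝ≥0, (b : ℝ) = B (x₁ : S1) := ⟨⟨_, (hBpos _).le⟩, rfl⟩
  set M := B (x₂ : S1) with hM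
  rw [← hb] at hx₁
  have hb0 : (0 : ℝ) < b := hb ▸ hBpos _
  have hbM : (b : ℝ) ≤ M := hx₁ _
  have hMpos : 0 < M := hb0.trans_le hbM
  have hinv : Continuous fun θ => (B θ)⁻¹ := hB.continuous.inv₀ fun θ => (hBpos θ).ne'
  set I := ∫ θ, (B θ)⁻¹ with hI
  have hIpos : 0 < I := lt_of_lt_of_le (by positivity) (two_pi_mul_le_integral (c := M⁻¹) hinv
    fun θ => inv_anti₀ (hBpos θ) (hx₂ θ))
  set C := 2 * M / (2 * Real.pi * (b / 2)) with hC
  set C₁ := (2 * M / (2 * Real.pi) * L / b ^ 2 + C) / b with hC₁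
  have hCpos : 0 < C := by positivity
  have hC₁pos : 0 < C₁ := by positivity
  -- With `η ≤ b/4` one has `b/2 ≤ h - η` and `h ≤ 2M`. The `min` serves both as lower bound for `u`
  -- and for `h - η`, the latter being needed in the derivative estimate. In the rate, `C₁` compares
  -- `u` with `J / B`, and the second term compares `J` with `γ`.
  refine ⟨min (b / 2 / (2 * Real.pi * (2 * M))) (b / 4), C, C₁ + 2 * Real.pi * C₁ / I / b, b / 4,
    by positivity, hCpos, by positivity, by positivity, ?_⟩
  intro a h u J η hη hflux ha hhB hupos hu1
  have hpos := fun θ => (ha θ).1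
  have hη0 : 0 < η := (ha 0).1.trans_le (ha 0).2
  have hhm : ∀ θ, (b : ℝ) / 2 ≤ h θ - η := fun θ => by
    have := (abs_le.1 (hhB θ)).1
    have := hx₁ θ
    linarith
  obtain ⟨⟨hJ, hJM⟩, hu⟩ := hflux.bounds (m := b / 2) (M := 2 * M) hpos hupos hu1 (by positivity)
    (fun θ => by linarith [hhm θ])
    (fun θ => by
      have := (abs_le.1 (hhB θ)).2
      have := hx₂ θ
      linarith)
  refine ⟨fun θ => ⟨(min_le_left _ _).trans (hu θ).1, (hu θ).2,
    (min_le_right _ _).trans (by linarith [hhm θ])⟩, ?_⟩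
  have hJM' : J ≤ 2 * M / (2 * Real.pi) := by rw [le_div_iff₀ hT]; linarith
  obtain ⟨j, rfl⟩ : ∃ j : ℝ≥0, (j : ℝ) = J := ⟨⟨J, hJ.le⟩, rfl⟩
  have hf := lipschitzWith_const_div hB (J := j) hb0 hx₁
  have key : ∀ θ, |h θ * u θ - j| ≤ a θ * (j * L / b ^ 2 : ℝ≥0) → |u θ - j / B θ| ≤ C₁ * η := by
    intro θ hθ
    push_cast at hθ
    have hBθ := hBpos θ
    have e : u θ - j / B θ = ((h θ * u θ - j) + (B θ - h θ) * u θ) / B θ := by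
      field_simp
      ring
    have h1 : |(B θ - h θ) * u θ| ≤ η * C := by
      rw [abs_mul, abs_sub_comm, abs_of_pos (hupos θ)]
      exact mul_le_mul (hhB θ) (hu θ).2 (hupos θ).le hη0.le
    have h2 : a θ * (j * L / b ^ 2) ≤ η * (2 * M / (2 * Real.pi) * L / b ^ 2) := by
      have := (ha θ).2
      gcongr
    rw [e, abs_div, abs_of_pos hBθ, hC₁, div_mul_eq_mul_div]
    refine div_le_div₀ (by positivity) ((abs_add_le _ _).trans ?_) hb0 (hx₁ θ)
    linarith
  obtain ⟨x, hx, hx'⟩ := hflux.exists_max_sub hpos hf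
  obtain ⟨y, hy, hy'⟩ := hflux.exists_min_sub hpos hf
  -- The bound at the maximum and minimum points of `u - J/B` controls this function everywhere.
  have hunif : ∀ θ, |u θ - j / B θ| ≤ C₁ * η := fun θ =>
    abs_le.2 ⟨(abs_le.1 (key _ hy')).1.trans (hy θ), (hx θ).trans (abs_le.1 (key _ hx')).2⟩
  have hint : ∫ θ, (u θ - j / B θ) = 1 - j * I := by
    simp only [div_eq_mul_inv]
    rw [integral_sub (integrable_of_continuous hflux.continuous _)
      (integrable_of_continuous (hinv.const_mul _) _), hu1, integral_const_mul]
  have hdc : Continuous fun θ => u θ - j / B θ := by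
    simp only [div_eq_mul_inv]
    exact hflux.continuous.sub (hinv.const_mul _)
  -- Integrating the uniform bound, with `∫ u = 1`, locates the flux.
  have hJI : |I⁻¹ - j| ≤ 2 * Real.pi * C₁ / I * η := by
    have h1 : |1 - j * I| ≤ 2 * Real.pi * (C₁ * η) := by
      rw [← hint]
      refine abs_le.2 ⟨?_, integral_le_two_pi_mul hdc fun θ => (abs_le.1 (hunif θ)).2⟩
      rw [← mul_neg]
      exact two_pi_mul_le_integral hdc fun θ => (abs_le.1 (hunif θ)).1
    have h2 : I⁻¹ - j = (1 - j * I) / I := by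
      field_simp
    rw [h2, abs_div, abs_of_pos hIpos, div_mul_eq_mul_div]
    gcongr
    linarith
  intro θ
  have e : u θ - I⁻¹ / B θ = (u θ - j / B θ) - (I⁻¹ - j) / B θ := by ring
  have h3 : |(I⁻¹ - j) / B θ| ≤ 2 * Real.pi * C₁ / I * η / b := by
    rw [abs_div, abs_of_pos (hBpos θ)]
    exact div_le_div₀ (by positivity) hJI hb0 (hx₁ θ)
  rw [e]
  calc _ ≤ |u θ - j / B θ| + |(I⁻¹ - j) / B θ| := abs_sub _ _
    _ ≤ C₁ * η + 2 * Real.pi * C₁ / I * η / b := add_le_add (hunif θ) h3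
    _ = _ := by ring

/-- The derivative of a flux solution with a Lipschitz coefficient `h` is bounded independently of
the ellipticity. -/
theorem IsFluxSolution.abs_deriv_le {a a' h u : S1 → ℝ} {J c C : ℝ} {L : ℝ≥0}
    (hflux : IsFluxSolution a h u J) (hpos : ∀ θ, 0 < a θ)
    (ha : ∀ x : ℝ, HasDerivAt (fun y : ℝ => a (y : S1)) (a' (x : S1)) x)
    (hh : LipschitzWith L h) (hc : 0 < c) (hca : ∀ θ, c ≤ h θ - a' θ)
    (hu : ∀ θ, 0 ≤ u θ ∧ u θ ≤ C) (θ : S1) : |(h θ * u θ - J) / a θ| ≤ L * C / c := by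
  have hC : 0 ≤ C := (hu 0).1.trans (hu 0).2
  have hac : Continuous a := continuous_iff_lift.2 <|
    continuous_iff_continuousAt.2 fun x => (ha x).continuousAt
  set v : S1 → ℝ := fun θ => (h θ * u θ - J) / a θ with hv
  have hvc : Continuous v :=
    ((hh.continuous.mul hflux.continuous).sub continuous_const).div hac fun θ => (hpos θ).ne'
  have hav : ∀ θ, a θ * v θ = h θ * u θ - J := fun θ => mul_div_cancel₀ _ (hpos θ).ne'
  -- Since `h` is only Lipschitz, `v = u'` cannot be differentiated; instead `h` and `v` are frozen
  -- at `x`. If `v` is maximal at `x`, then `v(x) a(y) ≥ v(y) a(y) = h(y) u(y) - J`, so the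
  -- increment of this function from `x` to `y` is at most `(h(x) - h(y)) u(y) ≤ L C (y - x)` for `y
  -- > x`. Its derivative at `x` is `(h - a') v`, whence `(h - a') v ≤ L C` there.
  have hF : ∀ x : ℝ, HasDerivAt (fun y : ℝ => h (x : S1) * u (y : S1) - v (x : S1) * a (y : S1))
      ((h (x : S1) - a' (x : S1)) * v (x : S1)) x := fun x =>
    (((hflux x).const_mul (h (x : S1))).sub ((ha x).const_mul (v (x : S1)))).congr_deriv
      (by simp only [hv]; ring)
  have hlip : ∀ x y : ℝ, x < y →
      |(h (y : S1) - h (x : S1)) * u (y : S1)| ≤ L * C * (y - x) := fun x y hxy => by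
    have h1 := hh.dist_le_mul (y : S1) (x : S1)
    have h2 := mul_le_mul_of_nonneg_left (dist_coe_le y x) (NNReal.coe_nonneg L)
    rw [abs_of_pos (sub_pos.2 hxy)] at h2
    rw [Real.dist_eq] at h1
    rw [abs_mul, abs_of_nonneg (hu _).1, mul_right_comm]
    exact mul_le_mul (h1.trans h2) (hu _).2 (hu _).1 (by nlinarith [L.2, sub_pos.2 hxy])
  have hdiv : ∀ t k : ℝ, c ≤ k → k * t ≤ L * C → t ≤ L * C / c := fun t k hk ht => by
    rw [le_div_iff₀ hc]
    rcases le_total 0 t with h0 | h0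
    · nlinarith
    · have := mul_nonneg L.2 hC
      simp only [NNReal.val_eq_coe] at this
      nlinarith
  obtain ⟨x, hx⟩ := exists_forall_le hvc
  obtain ⟨z, hz⟩ := exists_forall_ge hvc
  refine abs_le.2 ⟨?_, (hx θ).trans ?_⟩
  -- The same argument at the minimum of `v`, with the frozen function negated.
  · refine le_trans (neg_le.1 ?_) (hz θ)
    refine hdiv _ _ (hca (z : S1)) (le_of_eq_of_le (by ring)
      (deriv_le_of_forall_gt (hF z).neg fun y hy => ?_))
    have h1 := (abs_le.1 (hlip z y hy)).2
    have h2 := mul_le_mul_of_nonneg_left (hz (y : S1)) (hpos (y : S1)).le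
    have h3 := hav (y : S1)
    have h4 := hav (z : S1)
    simp only [Pi.neg_apply]
    nlinarith
  · refine hdiv _ _ (hca (x : S1)) (deriv_le_of_forall_gt (hF x) fun y hy => ?_)
    have h1 := (abs_le.1 (hlip x y hy)).1
    have h2 := mul_le_mul_of_nonneg_left (hx (y : S1)) (hpos (y : S1)).le
    have h3 := hav (y : S1)
    have h4 := hav (x : S1)
    nlinarith

/-! ### Size of the coefficients in terms of the smallness assumptions. -/

section Coefficients

variable {m : ℕ} {ε : ℝ} {B A₀ : S1 → ℝ} {A : Fin m → S1 → ℝ}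

theorem abs_iterate_D_le_ckNorm {f : S1 → ℝ} {k j : ℕ} (hjk : j ≤ k) (hf : IsCk j f) (θ : S1) :
    |D^[j] f θ| ≤ ckNorm k f := by
  have hc : Continuous (D^[j] f) := by
    clear hjk
    induction j generalizing f with
    | zero => exact hf.continuous
    | succ j ih => exact ih hf.deriv
  refine (le_supNorm hc θ).trans ?_
  exact Finset.single_le_sum (f := fun j => supNorm (D^[j] f)) (fun j _ => supNorm_nonneg _)
    (Finset.mem_range.2 (by omega))

theorem abs_sum_mul_le {f g : Fin m → ℝ} {N : Fin m → ℝ} (hf : ∀ i, |f i| ≤ N i)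
    (hg : ∀ i, |g i| ≤ N i) : |∑ i, f i * g i| ≤ ∑ i, N i ^ 2 := by
  refine (Finset.abs_sum_le_sum_abs _ _).trans (Finset.sum_le_sum fun i _ => ?_)
  rw [abs_mul, sq]
  exact mul_le_mul (hf i) (hg i) (abs_nonneg _) ((abs_nonneg _).trans (hf i))

theorem coefficient_bounds (hA₀ : Continuous A₀) (hA : ∀ i, IsCk 1 (A i)) (θ : S1) :
    diffusion ε A θ ≤ ε ^ 2 * (supNorm A₀ + ∑ i, ckNorm 1 (A i) ^ 2) ∧
    |diffusionDeriv ε A θ| ≤ ε ^ 2 * (supNorm A₀ + ∑ i, ckNorm 1 (A i) ^ 2) ∧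
    |fluxCoeff B ε A₀ A θ - B θ| ≤ ε ^ 2 * (supNorm A₀ + ∑ i, ckNorm 1 (A i) ^ 2) := by
  have hN : ∀ i, |A i θ| ≤ ckNorm 1 (A i) := fun i =>
    abs_iterate_D_le_ckNorm (j := 0) zero_le_one (isCk_zero_iff.2 (hA i).continuous) θ
  have hN' : ∀ i, |D (A i) θ| ≤ ckNorm 1 (A i) := fun i =>
    abs_iterate_D_le_ckNorm (j := 1) le_rfl (hA i) θ
  have h0 := le_supNorm hA₀ θ
  have h1 := abs_sum_mul_le hN hN
  have h2 := abs_sum_mul_le hN hN'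
  have hε : 0 ≤ ε ^ 2 := sq_nonneg ε
  have h0' := mul_le_mul_of_nonneg_left ((abs_nonneg _).trans h0) hε
  have h0'' := mul_le_mul_of_nonneg_left h0 hε
  have h1' := mul_le_mul_of_nonneg_left ((le_abs_self _).trans h1) hε
  have h2' := mul_le_mul_of_nonneg_left h2 hε
  have h3 : 0 ≤ ε ^ 2 * ∑ i, A i θ * A i θ :=
    mul_nonneg hε (Finset.sum_nonneg fun i _ => mul_self_nonneg _)
  have h4 : |diffusionDeriv ε A θ| ≤ ε ^ 2 * ∑ i, ckNorm 1 (A i) ^ 2 := by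
    rwa [diffusionDeriv, abs_mul, abs_of_nonneg hε]
  refine ⟨?_, ?_, ?_⟩
  · simp only [diffusion, pow_two (A _ θ)]
    linarith
  · linarith
  · rw [fluxCoeff, add_sub_cancel_left]
    refine (abs_sub _ _).trans ?_
    rw [abs_mul, abs_of_nonneg hε, abs_div, abs_two]
    linarith [abs_nonneg (diffusionDeriv ε A θ)]

theorem lipschitzWith_fluxCoeff {L : ℝ≥0} (hB : LipschitzWith L B) (hA₀ : IsCk 1 A₀)
    (hA : ∀ i, IsCk 2 (A i)) (hs : ε ^ 2 * (ckNorm 1 A₀ + ∑ i, ckNorm 2 (A i) ^ 2) ≤ 1) :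
    LipschitzWith (L + 1) (fluxCoeff B ε A₀ A) := by
  refine hB.add (lipschitzWith_of_abs_deriv_le (f' := fun x => ε ^ 2 * D A₀ (x : S1) -
    ε ^ 2 * (∑ i, D (A i) (x : S1) * D (A i) (x : S1) + ∑ i, A i (x : S1) * D (D (A i)) (x : S1))
      / 2) (fun x => ?_) fun x => ?_)
  · refine ((hA₀.hasDerivAt x).const_mul (ε ^ 2)).sub (HasDerivAt.div_const ?_ 2)
    refine HasDerivAt.const_mul _ ?_
    rw [← Finset.sum_add_distrib]
    exact HasDerivAt.fun_sum fun i _ => ((hA i).hasDerivAt x).mul ((hA i).deriv.hasDerivAt x)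
  · have h0 : |D A₀ (x : S1)| ≤ ckNorm 1 A₀ :=
      abs_iterate_D_le_ckNorm (j := 1) le_rfl hA₀ _
    have hN : ∀ i, |A i (x : S1)| ≤ ckNorm 2 (A i) := fun i =>
      abs_iterate_D_le_ckNorm (j := 0) zero_le_two (isCk_zero_iff.2 (hA i).continuous) _
    have hN' : ∀ i, |D (A i) (x : S1)| ≤ ckNorm 2 (A i) := fun i =>
      abs_iterate_D_le_ckNorm (j := 1) one_le_two (ContDiff.of_le (hA i) (by norm_num)) _
    have hN'' : ∀ i, |D (D (A i)) (x : S1)| ≤ ckNorm 2 (A i) := fun i =>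
      abs_iterate_D_le_ckNorm (j := 2) le_rfl (hA i) _
    have h1 := abs_sum_mul_le hN' hN'
    have h2 := abs_sum_mul_le hN hN''
    have hε : 0 ≤ ε ^ 2 := sq_nonneg ε
    have h3 := mul_le_mul_of_nonneg_left h0 hε
    have h4 := mul_le_mul_of_nonneg_left ((abs_add_le _ _).trans (add_le_add h1 h2)) hε
    refine (abs_sub _ _).trans ?_
    rw [abs_mul, abs_of_nonneg hε, abs_div, abs_mul, abs_of_nonneg hε, abs_two, NNReal.coe_one]
    linarith

end Coefficients

/-! ### The flow of the ODE and its invariant measure. -/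

/-- A time change that linearises the flow of a positive vector field. -/
theorem exists_flow_coordinate {B : S1 → ℝ} (hB : Continuous B) (hBpos : ∀ θ, 0 < B θ) :
    ∃ G : ℝ ≃ₜ ℝ, (∀ x : ℝ, HasDerivAt G (B (x : S1))⁻¹ x) ∧
      (∀ x, G (x + 2 * Real.pi) = G x + ∫ θ, (B θ)⁻¹) ∧
      ∀ x, HasDerivAt G.symm (B (G.symm x : S1)) x := by
  have hinv : Continuous fun x : ℝ => (B (x : S1))⁻¹ :=
    (continuous_iff_lift.1 hB).inv₀ fun x => (hBpos _).ne'
  have hG' := hasDerivAt_integral hinv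
  set G : ℝ → ℝ := fun y => ∫ t in (0 : ℝ)..y, (B (t : S1))⁻¹ with hG
  have hGc : Continuous G := continuous_iff_continuousAt.2 fun x => (hG' x).continuousAt
  have hmono : StrictMono G := strictMono_of_hasDerivAt_pos hG' fun x => inv_pos.2 (hBpos _)
  have hper : ∀ x, G (x + 2 * Real.pi) = G x + ∫ θ, (B θ)⁻¹ := fun x => by
    rw [integral_eq_interval _ x, hG]
    exact (intervalIntegral.integral_add_adjacent_intervals (hinv.intervalIntegrable _ _)
      (hinv.intervalIntegrable _ _)).symm
  obtain ⟨x₀, hx₀⟩ := exists_forall_le hB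
  have hM := hBpos (x₀ : S1)
  set M := B (x₀ : S1)
  -- `G' ≥ 1/max B` forces at least linear growth at both ends, hence surjectivity of `G`.
  have hmonoM : Monotone fun x => G x - M⁻¹ * x :=
    monotone_of_deriv_nonneg (fun x => ((hG' x).sub
      ((hasDerivAt_id x).const_mul M⁻¹)).differentiableAt) fun x => by
      have := ((hG' x).sub ((hasDerivAt_id x).const_mul M⁻¹)).deriv
      simp only [id] at this
      refine le_of_le_of_eq ?_ this.symm
      rw [mul_one, sub_nonneg]
      exact inv_anti₀ (hBpos _) (hx₀ _)
  have hG0 : G 0 = 0 := by simp [hG]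
  have htop : Tendsto G atTop atTop := by
    refine tendsto_atTop_mono' _ ?_ (tendsto_id.const_mul_atTop (inv_pos.2 hM))
    filter_upwards [eventually_ge_atTop 0] with x hx
    have := hmonoM hx
    simp only [hG0, mul_zero, sub_zero] at this
    simp only [id]
    linarith
  have hbot : Tendsto G atBot atBot := by
    refine tendsto_atBot_mono' _ ?_ (tendsto_id.const_mul_atBot (inv_pos.2 hM))
    filter_upwards [eventually_le_atBot 0] with x hx
    have := hmonoM hx
    simp only [hG0, mul_zero, sub_zero] at this
    simp only [id]
    linarith
  let e := (hmono.orderIsoOfSurjective G (hGc.surjective htop hbot)).toHomeomorph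
  have he : ∀ x, e x = G x := fun x => rfl
  refine ⟨e, hG', hper, fun x => ?_⟩
  have := (hG' (e.symm x)).of_local_left_inverse (f := G) (g := e.symm) (a := x)
    e.symm.continuous.continuousAt (inv_ne_zero (hBpos _).ne')
    (Eventually.of_forall fun y => e.apply_symm_apply y)
  rwa [inv_inv] at this

section Flow

variable {B : S1 → ℝ} {G : ℝ ≃ₜ ℝ}

/-- `G` measures travel time: along a solution `G(γ(t)) - t` has zero derivative. Uniqueness of the
flow comes from this and not from a general ODE theorem. -/
theorem flow_coordinate_solution (hBpos : ∀ θ, 0 < B θ)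
    (hG : ∀ x : ℝ, HasDerivAt G (B (x : S1))⁻¹ x) {γ : ℝ → ℝ}
    (hγ : ∀ t, HasDerivAt γ (B (γ t : S1)) t) (t : ℝ) : γ t = G.symm (G (γ 0) + t) := by
  have hd : ∀ t, HasDerivAt (fun t => G (γ t) - t) 0 t := fun t =>
    (((hG (γ t)).comp t (hγ t)).sub (hasDerivAt_id t)).congr_deriv (by
      rw [inv_mul_cancel₀ (hBpos _).ne', sub_self])
  have := is_const_of_deriv_eq_zero (fun x => (hd x).differentiableAt) (fun x => (hd x).deriv) t 0
  rw [Homeomorph.eq_symm_apply]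
  linarith

/-- The orbit integral of `f` over one period equals the integral of `f / B`. -/
theorem integral_orbit (hB : Continuous B) (hBpos : ∀ θ, 0 < B θ)
    (hper : ∀ x, G (x + 2 * Real.pi) = G x + ∫ θ, (B θ)⁻¹)
    (hG' : ∀ x, HasDerivAt G.symm (B (G.symm x : S1)) x) {f : S1 → ℝ} (hf : Continuous f) (x : ℝ) :
    ∫ t in (0 : ℝ)..∫ θ, (B θ)⁻¹, f (G.symm (G x + t) : S1) = ∫ θ, f θ / B θ := by
  have hBl := continuous_iff_lift.1 hB
  have hfB : Continuous fun y : ℝ => f (y : S1) / B (y : S1) :=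
    (continuous_iff_lift.1 hf).div hBl fun _ => (hBpos _).ne'
  have hd : ∀ t, HasDerivAt (fun t => G.symm (G x + t)) (B (G.symm (G x + t) : S1)) t :=
    fun t => (hG' (G x + t)).comp_const_add (G x) t
  have h := intervalIntegral.integral_comp_mul_deriv (a := 0) (b := ∫ θ, (B θ)⁻¹)
    (fun t _ => hd t)
    (hBl.comp (G.symm.continuous.comp (continuous_const.add continuous_id))).continuousOn hfB
  rw [add_zero, ← hper, G.symm_apply_apply, G.symm_apply_apply,
    ← integral_eq_interval (fun θ => f θ / B θ)] at h
  rw [← h]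
  refine intervalIntegral.integral_congr fun t _ => ?_
  simp only [Function.comp_apply]
  exact (div_mul_cancel₀ _ (hBpos _).ne').symm

theorem flow_coordinate_symm_periodic
    (hper : ∀ x, G (x + 2 * Real.pi) = G x + ∫ θ, (B θ)⁻¹) (y : ℝ) :
    (G.symm (y + ∫ θ, (B θ)⁻¹) : S1) = (G.symm y : S1) := by
  have : G.symm (y + ∫ θ, (B θ)⁻¹) = G.symm y + 2 * Real.pi := by
    rw [Homeomorph.symm_apply_eq, hper, G.apply_symm_apply]
  rw [this, coe_add_two_pi]

theorem flow_coordinate_lift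
    (hper : ∀ x, G (x + 2 * Real.pi) = G x + ∫ θ, (B θ)⁻¹) {x y : ℝ} (h : (x : S1) = (y : S1))
    (t : ℝ) : (G.symm (G x + t) : S1) = (G.symm (G y + t) : S1) := by
  have hp : Function.Periodic (fun x => (G.symm (G x + t) : S1)) (2 * Real.pi) := fun x => by
    simp only
    rw [hper, add_right_comm, flow_coordinate_symm_periodic hper]
  rw [← hp.lift_coe, ← hp.lift_coe y]
  exact congrArg _ h

theorem isFlow_iff (hBpos : ∀ θ, 0 < B θ) (hG : ∀ x : ℝ, HasDerivAt G (B (x : S1))⁻¹ x)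
    (hper : ∀ x, G (x + 2 * Real.pi) = G x + ∫ θ, (B θ)⁻¹)
    (hG' : ∀ x, HasDerivAt G.symm (B (G.symm x : S1)) x) (φ : ℝ → S1 → S1) :
    IsFlow B φ ↔ ∀ t (x : ℝ), φ t (x : S1) = (G.symm (G x + t) : S1) := by
  constructor
  · intro h t x
    obtain ⟨h0, γ, hγ, hγ'⟩ := h (x : S1)
    refine (hγ t).symm.trans ?_
    rw [flow_coordinate_solution hBpos hG hγ' t]
    exact flow_coordinate_lift hper ((hγ 0).trans h0) t
  · intro h
    refine forall_S1.2 fun x => ⟨?_, fun t => G.symm (G x + t), fun t => (h t x).symm, fun t => ?_⟩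
    · rw [h, add_zero, G.symm_apply_apply]
    · exact (hG' (G x + t)).comp_const_add (G x) t

/-- Every orbit has period `T = ∫ 1/B`, and the integral of `f` along one period is `∫ f / B`,
whatever the starting point. Integrating over an invariant measure and exchanging integrals
therefore gives `T ∫ f dμ = ∫ f / B`. -/
theorem isInvariantMeasure_iff (hB : Continuous B) (hBpos : ∀ θ, 0 < B θ) {u₀ : S1 → ℝ}
    (hu₀ : ∀ θ, u₀ θ = (∫ θ, (B θ)⁻¹)⁻¹ / B θ) (hu₀c : Continuous u₀) (hu₀pos : ∀ θ, 0 < u₀ θ)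
    (μ : Measure S1) : IsInvariantMeasure B μ ↔ μ = densityMeasure u₀ := by
  obtain ⟨G, hG, hper, hG'⟩ := exists_flow_coordinate hB hBpos
  have hinv : Continuous fun θ => (B θ)⁻¹ := hB.inv₀ fun θ => (hBpos θ).ne'
  have hTpos : 0 < ∫ θ, (B θ)⁻¹ := by
    obtain ⟨x, hx⟩ := exists_forall_ge hinv
    exact lt_of_lt_of_le (mul_pos Real.two_pi_pos (inv_pos.2 (hBpos _)))
      (two_pi_mul_le_integral hinv hx)
  have horbit := fun {f : S1 → ℝ} (hf : Continuous f) x => integral_orbit hB hBpos hper hG' hf x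
  have hlift := fun {x y : ℝ} (h : (x : S1) = y) t => flow_coordinate_lift hper h t
  have hperT := flow_coordinate_symm_periodic hper
  set T := ∫ θ, (B θ)⁻¹ with hT
  have hu₀f : ∀ f : S1 → ℝ, ∫ θ, u₀ θ * f θ = T⁻¹ * ∫ θ, f θ / B θ := fun f => by
    rw [← integral_const_mul]
    refine integral_congr_ae (Eventually.of_forall fun θ => ?_)
    simp only [hu₀]
    ring
  have hu1 : ∫ θ, u₀ θ = 1 := by
    have := hu₀f fun _ => 1
    simp only [mul_one, one_div] at this
    rw [this, inv_mul_cancel₀ hTpos.ne']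
  obtain ⟨Φ, hΦ⟩ : ∃ Φ : ℝ → S1 → S1, ∀ t (x : ℝ), Φ t (x : S1) = (G.symm (G x + t) : S1) := by
    choose Φ hΦ using fun t : ℝ => exists_lift (g := fun x => (G.symm (G x + t) : S1))
      fun x => hlift (coe_add_two_pi x) t
    exact ⟨Φ, hΦ⟩
  have hΦc : ∀ t, Continuous (Φ t) := fun t => by
    rw [continuous_iff_lift]
    simp only [hΦ]
    exact (AddCircle.continuous_mk' _).comp
      (G.symm.continuous.comp (G.continuous.add continuous_const))
  -- Joint continuity supplies the measurability for Fubini. The covering map is an open quotient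
  -- map, so its product with the identity is still a quotient map.
  have hΦjoint : Continuous fun p : ℝ × S1 => Φ p.1 p.2 := by
    have hq : IsOpenQuotientMap fun x : ℝ => (x : S1) := QuotientAddGroup.isOpenQuotientMap_mk
    rw [(IsOpenQuotientMap.id.prodMap hq).isQuotientMap.continuous_iff]
    refine (continuous_congr fun p => ?_).2 ((AddCircle.continuous_mk' _).comp
      (G.symm.continuous.comp ((G.continuous.comp continuous_snd).add continuous_fst)))
    exact hΦ p.1 p.2
  have hΦorbit : ∀ {f : S1 → ℝ}, Continuous f → ∀ θ,
      ∫ t in (0 : ℝ)..T, f (Φ t θ) = ∫ θ, f θ / B θ := fun {f} hf => forall_S1.2 fun x => by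
    simp only [hΦ]
    exact horbit hf x
  have hfub : ∀ {f : S1 → ℝ}, Continuous f → ∀ (ν : Measure S1) [IsProbabilityMeasure ν],
      ∫ t in (0 : ℝ)..T, ∫ θ, f (Φ t θ) ∂ν = ∫ θ, f θ / B θ := fun {f} hf ν _ => by
    rw [intervalIntegral_integral_swap]
    · simp only [hΦorbit hf, integral_const, probReal_univ, one_smul]
    · obtain ⟨x, hx⟩ := exists_forall_le hf.abs
      rw [Set.uIoc_of_le hTpos.le]
      exact Integrable.of_bound (hf.comp hΦjoint).aestronglyMeasurable _
        (Eventually.of_forall fun p => hx _)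
  constructor
  · rintro ⟨hμ, φ, hφ, hpres⟩
    have hφ' := (isFlow_iff hBpos hG hper hG' φ).1 hφ
    obtain rfl : φ = Φ := funext fun t => funext <| forall_S1.2 fun x => by rw [hφ', hΦ]
    refine measure_eq_densityMeasure hu₀c hu₀pos hu1 fun f hf => ?_
    rw [hu₀f, ← hfub hf μ]
    have : ∀ t, ∫ θ, f (φ t θ) ∂μ = ∫ θ, f θ ∂μ := fun t => by
      rw [← integral_map (hpres t).measurable.aemeasurable hf.aestronglyMeasurable, (hpres t).map_eq]
    simp only [this, intervalIntegral.integral_const, sub_zero, smul_eq_mul]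
    rw [inv_mul_cancel_left₀ hTpos.ne']
  · rintro rfl
    have hprob := densityMeasure_isProbabilityMeasure hu₀c hu₀pos hu1
    refine ⟨hprob, Φ, (isFlow_iff hBpos hG hper hG' Φ).2 hΦ, fun s => ⟨(hΦc s).measurable, ?_⟩⟩
    have := Measure.isProbabilityMeasure_map (μ := densityMeasure u₀)
      (hΦc s).measurable.aemeasurable
    refine measure_eq_densityMeasure hu₀c hu₀pos hu1 fun f hf => ?_
    rw [integral_map (hΦc s).measurable.aemeasurable hf.aestronglyMeasurable,
      integral_densityMeasure hu₀c hu₀pos, hu₀f, hu₀f, ← hΦorbit hf 0]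
    -- Both integrals are written along the orbit of `0`; applying `Φ s` shifts time by `s`, which
    -- does not change an integral over a full period.
    refine congrArg _ ((hΦorbit (hf.comp (hΦc s)) 0).symm.trans ?_)
    have hadd : ∀ t, Φ s (Φ t 0) = Φ (t + s) 0 := fun t => by
      rw [← AddCircle.coe_zero, hΦ, hΦ, hΦ, G.apply_symm_apply, add_assoc]
    have hp : Function.Periodic (fun t => f (Φ t 0)) T := fun t => by
      simp only
      rw [← AddCircle.coe_zero, hΦ, hΦ, ← add_assoc, hperT]
    simp only [Function.comp_apply, hadd]
    rw [intervalIntegral.integral_comp_add_right (fun t => f (Φ t 0)), zero_add, add_comm,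
      hp.intervalIntegral_add_eq s 0, zero_add]

end Flow

/-! ### From uniform convergence to weak `L^p` and Hölder convergence. -/

theorem exists_Ioo_of_eventually {p : ℝ → Prop} (h : ∀ᶠ ε in 𝓝[>] (0 : ℝ), p ε) {ε₀ : ℝ}
    (hε₀ : 0 < ε₀) : ∃ ε₁ : ℝ, 0 < ε₁ ∧ ε₁ ≤ ε₀ ∧ ∀ ε ∈ Set.Ioo 0 ε₁, p ε := by
  obtain ⟨δ, hδ, hsub⟩ := mem_nhdsGT_iff_exists_Ioo_subset.1 h
  exact ⟨min δ ε₀, lt_min hδ hε₀, min_le_right _ _,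
    fun ε hε => hsub ⟨hε.1, hε.2.trans_le (min_le_left _ _)⟩⟩

theorem TendstoWeaklyLp.of_tendsto {p : ℝ≥0∞} [Fact (1 ≤ p)] {u : ℝ → C(S1, ℝ)} {u₀ : C(S1, ℝ)}
    (h : Tendsto u (𝓝[>] 0) (𝓝 u₀)) : TendstoWeaklyLp p u u₀ :=
  (((toWeakSpaceCLM ℝ (Lp ℝ p (volume : Measure S1))).continuous.comp
    (ContinuousMap.toLp p (volume : Measure S1) ℝ).continuous).tendsto u₀).comp h

/-- Interpolation: split the increment as its powers `1 - α` and `α`, and bound the first by the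
supremum norm and the second by the Lipschitz constant. -/
theorem holderENorm_le {w : C(S1, ℝ)} {Λ α : ℝ≥0} (hΛ : LipschitzWith Λ w) (hα : α < 1) :
    holderENorm α w ≤
      ENNReal.ofReal ‖w‖ + ((2 * ‖w‖₊) ^ (1 - α : ℝ) * Λ ^ (α : ℝ) : ℝ≥0) := by
  have hα' : (0 : ℝ) < 1 - α := sub_pos.2 (by exact_mod_cast hα)
  refine add_le_add le_rfl (HolderWith.eHolderNorm_le fun x y => ?_)
  rw [edist_nndist, edist_nndist, ← ENNReal.coe_rpow_of_nonneg _ α.coe_nonneg, ← ENNReal.coe_mul,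
    ENNReal.coe_le_coe]
  have h1 : nndist (w x) (w y) ≤ 2 * ‖w‖₊ := by
    rw [← NNReal.coe_le_coe, coe_nndist, dist_eq_norm, NNReal.coe_mul, coe_nnnorm, NNReal.coe_two,
      show 2 * ‖w‖ = ‖w‖ + ‖w‖ from two_mul _]
    exact (norm_sub_le _ _).trans (add_le_add (w.norm_coe_le_norm x) (w.norm_coe_le_norm y))
  have h2 : nndist (w x) (w y) ≤ Λ * nndist x y := hΛ.nndist_le x y
  calc nndist (w x) (w y)
      = nndist (w x) (w y) ^ (1 - α : ℝ) * nndist (w x) (w y) ^ (α : ℝ) := by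
        rw [← NNReal.rpow_add_of_nonneg _ hα'.le α.coe_nonneg, sub_add_cancel, NNReal.rpow_one]
    _ ≤ (2 * ‖w‖₊) ^ (1 - α : ℝ) * (Λ * nndist x y) ^ (α : ℝ) :=
        mul_le_mul' (NNReal.rpow_le_rpow h1 hα'.le) (NNReal.rpow_le_rpow h2 α.2)
    _ = _ := by rw [NNReal.mul_rpow (x := Λ), mul_assoc]

theorem TendstoHolder.of_tendsto {u : ℝ → C(S1, ℝ)} {u₀ : C(S1, ℝ)} {Λ α : ℝ≥0}
    (h : Tendsto u (𝓝[>] 0) (𝓝 u₀)) (hΛ : ∀ᶠ ε in 𝓝[>] (0 : ℝ), LipschitzWith Λ (u ε - u₀))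
    (hα : α < 1) : TendstoHolder α u u₀ := by
  have hα' : (0 : ℝ) < 1 - α := sub_pos.2 (by exact_mod_cast hα)
  have h0 : Tendsto (fun ε => ‖u ε - u₀‖₊) (𝓝[>] 0) (𝓝 0) := by
    have := (h.sub_const u₀).nnnorm
    rwa [sub_self, nnnorm_zero] at this
  have h0' : Tendsto (fun ε => ‖u ε - u₀‖) (𝓝[>] 0) (𝓝 0) := by
    have := (h.sub_const u₀).norm
    rwa [sub_self, norm_zero] at this
  have h1 : Tendsto (fun ε => (2 * ‖u ε - u₀‖₊) ^ (1 - α : ℝ) * Λ ^ (α : ℝ)) (𝓝[>] 0) (𝓝 0) := by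
    have := ((((NNReal.continuous_rpow_const hα'.le).tendsto _).comp
      (h0.const_mul 2)).mul_const (Λ ^ (α : ℝ)))
    rwa [mul_zero, NNReal.zero_rpow hα'.ne', zero_mul] at this
  have h2 := (ENNReal.tendsto_ofReal h0').add (ENNReal.tendsto_coe.2 h1)
  rw [ENNReal.ofReal_zero, ENNReal.coe_zero, add_zero] at h2
  exact tendsto_of_tendsto_of_tendsto_of_le_of_le' tendsto_const_nhds h2
    (Eventually.of_forall fun _ => zero_le) (hΛ.mono fun ε hε => holderENorm_le hε hα)

end CircleSDE

/-! ### Assembly of the main theorem. -/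

theorem theorem4p2
    (B : CircleSDE.S1 → ℝ) (hBlip : ∃ K : ℝ≥0, LipschitzWith K B) (hBpos : ∀ θ, 0 < B θ)
    (m : ℕ) (ε₀ : ℝ) (hε₀ : 0 < ε₀)
    (A₀ : ℝ → CircleSDE.S1 → ℝ) (A : ℝ → Fin m → CircleSDE.S1 → ℝ)
    (hA₀ : ∀ ε ∈ Set.Ioo 0 ε₀, Continuous (A₀ ε))
    (hA : ∀ ε ∈ Set.Ioo 0 ε₀, ∀ i, CircleSDE.IsCk 1 (A ε i))
    (hlim : Tendsto
      (fun ε : ℝ => ε ^ 2 *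
        (CircleSDE.supNorm (A₀ ε) + ∑ i, CircleSDE.ckNorm 1 (A ε i) ^ 2))
      (𝓝[>] 0) (𝓝 0))
    (hnondeg : ∀ ε ∈ Set.Ioo 0 ε₀, ∀ θ, 0 < ∑ i, (A ε i θ) ^ 2) :
    ∃ (u₀ : C(CircleSDE.S1, ℝ)) (u : ℝ → C(CircleSDE.S1, ℝ)),
      -- `u₀ = γ / B` is the positive density of the unique invariant measure of `ẋ = B(x)`
      (∀ θ, 0 < u₀ θ ∧ u₀ θ = (∫ x : CircleSDE.S1, (B x)⁻¹)⁻¹ / B θ) ∧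
      (∀ μ : Measure CircleSDE.S1,
        CircleSDE.IsInvariantMeasure B μ ↔ μ = CircleSDE.densityMeasure u₀) ∧
      -- `u ε` is the positive density of the unique stationary measure of the perturbed SDE
      (∀ ε ∈ Set.Ioo 0 ε₀, (∀ θ, 0 < u ε θ) ∧
        ∀ μ : Measure CircleSDE.S1,
          CircleSDE.IsStationaryMeasure (CircleSDE.drift B ε (A₀ ε))
            (CircleSDE.noise ε (A ε)) μ ↔ μ = CircleSDE.densityMeasure (u ε)) ∧
      -- uniform bounds and weak convergence
      (∃ c C ε₁ : ℝ, 0 < c ∧ 0 < C ∧ 0 < ε₁ ∧ ε₁ ≤ ε₀ ∧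
        ∀ ε ∈ Set.Ioo 0 ε₁, ∀ θ, c ≤ u ε θ ∧ u ε θ ≤ C) ∧
      (∀ (p : ℝ≥0∞) [Fact (1 ≤ p)], 1 < p → p ≠ ⊤ → CircleSDE.TendstoWeaklyLp p u u₀) ∧
      -- the improvement under stronger regularity of the coefficients
      ((∀ ε ∈ Set.Ioo 0 ε₀, CircleSDE.IsCk 1 (A₀ ε)) →
        (∀ ε ∈ Set.Ioo 0 ε₀, ∀ i, CircleSDE.IsCk 2 (A ε i)) →
        Tendsto
          (fun ε : ℝ => ε ^ 2 *
            (CircleSDE.ckNorm 1 (A₀ ε) + ∑ i, CircleSDE.ckNorm 2 (A ε i) ^ 2))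
          (𝓝[>] 0) (𝓝 0) →
        (∀ ε ∈ Set.Ioo 0 ε₀, CircleSDE.IsCk 1 (u ε)) ∧
        (∃ C ε₁ : ℝ, 0 < C ∧ 0 < ε₁ ∧ ε₁ ≤ ε₀ ∧
          ∀ ε ∈ Set.Ioo 0 ε₁, ∀ θ, |CircleSDE.D (u ε) θ| ≤ C) ∧
        (∀ α : ℝ≥0, 0 < α → α < 1 → CircleSDE.TendstoHolder α u u₀)) := by
  obtain ⟨L, hL⟩ := hBlip
  have hBc : Continuous B := hL.continuous
  obtain ⟨x₁, hx₁⟩ := CircleSDE.exists_forall_ge hBc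
  obtain ⟨b, hb⟩ : ∃ b : ℝ≥0, (b : ℝ) = B (x₁ : CircleSDE.S1) := ⟨⟨_, (hBpos _).le⟩, rfl⟩
  have hb0 : 0 < b := NNReal.coe_pos.1 (hb ▸ hBpos _)
  have hinv : Continuous fun θ => (B θ)⁻¹ := hBc.inv₀ fun θ => (hBpos θ).ne'
  obtain ⟨x₂, hx₂⟩ := CircleSDE.exists_forall_ge hinv
  have hIpos : 0 < ∫ θ, (B θ)⁻¹ :=
    lt_of_lt_of_le (mul_pos Real.two_pi_pos (inv_pos.2 (hBpos _)))
      (CircleSDE.two_pi_mul_le_integral hinv hx₂)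
  obtain ⟨γ, hγ⟩ : ∃ γ : ℝ≥0, (γ : ℝ) = (∫ θ, (B θ)⁻¹)⁻¹ := ⟨⟨_, (inv_pos.2 hIpos).le⟩, rfl⟩
  have hγpos : (0 : ℝ) < γ := hγ ▸ inv_pos.2 hIpos
  have hu₀L := CircleSDE.lipschitzWith_const_div hL (J := γ) hb0 (fun θ => hb ▸ hx₁ θ)
  let u₀ : C(CircleSDE.S1, ℝ) := ⟨fun θ => (γ : ℝ) / B θ, hu₀L.continuous⟩
  have hu₀ : ∀ θ, u₀ θ = (∫ θ, (B θ)⁻¹)⁻¹ / B θ := fun θ => by rw [← hγ]; rfl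
  have hu₀pos : ∀ θ, 0 < u₀ θ := fun θ => div_pos hγpos (hBpos θ)
  have hex : ∀ ε, ∃ (u : C(CircleSDE.S1, ℝ)) (J : ℝ), ε ∈ Set.Ioo 0 ε₀ →
      (∀ θ, 0 < u θ) ∧ ∫ θ, u θ = 1 ∧ CircleSDE.IsFluxSolution (CircleSDE.diffusion ε (A ε))
        (CircleSDE.fluxCoeff B ε (A₀ ε) (A ε)) u J := fun ε => by
    by_cases hε : ε ∈ Set.Ioo 0 ε₀
    · obtain ⟨u, J, h⟩ := CircleSDE.exists_isFluxSolution
        (CircleSDE.continuous_diffusion (ε := ε) (hA ε hε))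
        (CircleSDE.diffusion_pos hε.1 (hnondeg ε hε))
        (CircleSDE.continuous_fluxCoeff (ε := ε) hBc (hA₀ ε hε) (hA ε hε))
      exact ⟨u, J, fun _ => h⟩
    -- Outside the parameter range the density is arbitrary; the limits only see small positive `ε`.
    · exact ⟨0, 0, fun h => absurd h hε⟩
  choose u J hu using hex
  obtain ⟨c, C, K, η₀, hc, hC, hK, hη₀, hunif⟩ := CircleSDE.exists_uniform_bounds hL hBpos
  obtain ⟨ε₁, hε₁, hε₁₀, hs⟩ := CircleSDE.exists_Ioo_of_eventually
    (hlim.eventually (eventually_le_nhds hη₀)) hε₀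
  have hmem : ∀ {ε}, ε ∈ Set.Ioo 0 ε₁ → ε ∈ Set.Ioo 0 ε₀ := fun hε => ⟨hε.1, hε.2.trans_le hε₁₀⟩
  have hpos := fun {ε} (hε : ε ∈ Set.Ioo 0 ε₀) => CircleSDE.diffusion_pos hε.1 (hnondeg ε hε)
  have hcoef := fun {ε} (hε : ε ∈ Set.Ioo 0 ε₀) =>
    CircleSDE.coefficient_bounds (ε := ε) (B := B) (hA₀ ε hε) (hA ε hε)
  have hest := fun ε (hε : ε ∈ Set.Ioo 0 ε₁) => hunif _ _ _ _ _ (hs ε hε) (hu ε (hmem hε)).2.2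
    (fun θ => ⟨hpos (hmem hε) θ, (hcoef (hmem hε) θ).1⟩)
    (fun θ => (hcoef (hmem hε) θ).2.2) (hu ε (hmem hε)).1 (hu ε (hmem hε)).2.1
  have hev : ∀ᶠ ε in 𝓝[>] (0 : ℝ), ε ∈ Set.Ioo 0 ε₁ := Ioo_mem_nhdsGT hε₁
  have htend : Tendsto u (𝓝[>] 0) (𝓝 u₀) := by
    rw [tendsto_iff_norm_sub_tendsto_zero]
    have h0 := hlim.const_mul K
    rw [mul_zero] at h0
    refine tendsto_of_tendsto_of_tendsto_of_le_of_le' tendsto_const_nhds h0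
      (Eventually.of_forall fun _ => norm_nonneg _) (hev.mono fun ε hε => ?_)
    have h1 := (hest ε hε).2
    rw [ContinuousMap.norm_le_of_nonempty]
    intro θ
    rw [ContinuousMap.sub_apply, hu₀]
    exact h1 θ
  refine ⟨u₀, u, fun θ => ⟨hu₀pos θ, hu₀ θ⟩,
    CircleSDE.isInvariantMeasure_iff hBc hBpos hu₀ u₀.continuous hu₀pos,
    fun ε hε => ⟨(hu ε hε).1, CircleSDE.isStationaryMeasure_iff hBc (hA₀ ε hε) (hA ε hε) hε.1
      (hnondeg ε hε) (u ε).continuous (hu ε hε).1 (hu ε hε).2.1 (hu ε hε).2.2⟩,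
    ⟨c, C, ε₁, hc, hC, hε₁, hε₁₀, fun ε hε θ => ⟨((hest ε hε).1 θ).1, ((hest ε hε).1 θ).2.1⟩⟩,
    fun p _ _ _ => CircleSDE.TendstoWeaklyLp.of_tendsto htend, fun hA₀' hA' hlim' => ?_⟩
  have hCk : ∀ ε ∈ Set.Ioo 0 ε₀, CircleSDE.IsCk 1 (u ε) ∧ ∀ θ, CircleSDE.D (u ε) θ =
      (CircleSDE.fluxCoeff B ε (A₀ ε) (A ε) θ * u ε θ - J ε) / CircleSDE.diffusion ε (A ε) θ :=
    fun ε hε => CircleSDE.isCk_one_of_hasDerivAt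
      ((((CircleSDE.continuous_fluxCoeff hBc (hA₀ ε hε) (hA ε hε)).mul (u ε).continuous).sub
        continuous_const).div (CircleSDE.continuous_diffusion (hA ε hε))
        fun θ => (hpos hε θ).ne') (hu ε hε).2.2
  obtain ⟨ε₂, hε₂, hε₂₁, hs'⟩ := CircleSDE.exists_Ioo_of_eventually
    (hlim'.eventually (eventually_le_nhds one_pos)) hε₁
  have hD : ∀ ε ∈ Set.Ioo 0 ε₂, ∀ θ, |CircleSDE.D (u ε) θ| ≤ (L + 1 : ℝ≥0) * C / c :=
    fun ε hε θ => by
      have hε' : ε ∈ Set.Ioo 0 ε₁ := ⟨hε.1, hε.2.trans_le hε₂₁⟩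
      have hε'' := hmem hε'
      rw [(hCk ε hε'').2]
      refine (hu ε hε'').2.2.abs_deriv_le (hpos hε'')
        (CircleSDE.hasDerivAt_diffusion (hA ε hε''))
        (CircleSDE.lipschitzWith_fluxCoeff hL (hA₀' ε hε'') (hA' ε hε'') (hs' ε hε)) hc
        (fun θ => ?_) (fun θ => ⟨((hu ε hε'').1 θ).le, ((hest ε hε').1 θ).2.1⟩) θ
      -- The same quantity `η` bounds `|a'|`, so `c ≤ h - η` gives `c ≤ h - a'`.
      have h1 := (le_abs_self _).trans (hcoef hε'' θ).2.1
      have h2 := ((hest ε hε').1 θ).2.2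
      linarith
  refine ⟨fun ε hε => (hCk ε hε).1,
    ⟨(L + 1 : ℝ≥0) * C / c, ε₂, by positivity, hε₂, hε₂₁.trans hε₁₀, hD⟩, fun α _ hα => ?_⟩
  obtain ⟨C', hC'⟩ : ∃ C' : ℝ≥0, (C' : ℝ) = (L + 1 : ℝ≥0) * C / c := ⟨⟨_, by positivity⟩, rfl⟩
  have hev₂ : ∀ᶠ ε in 𝓝[>] (0 : ℝ), ε ∈ Set.Ioo 0 ε₂ := Ioo_mem_nhdsGT hε₂
  -- The derivative bound on `u ε` plus the Lipschitz constant of `γ / B`.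
  refine CircleSDE.TendstoHolder.of_tendsto (Λ := C' + γ * L / b ^ 2) htend
    (hev₂.mono fun ε hε => ?_) hα
  have hε'' := hmem ⟨hε.1, hε.2.trans_le hε₂₁⟩
  exact (CircleSDE.lipschitzWith_of_abs_deriv_le (hCk ε hε'').1.hasDerivAt
    (fun x => hC' ▸ hD ε hε _)).sub hu₀L
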